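/- For a complex manifold $X$ let $T_X$ denote its holomorphic tangent bundle, and let $H^0(X,T_X)$ and $H^0(X,\wedge^2T_X)$ denote the complex vector spaces of global holomorphic vector fields and of global holomorphic bivector fields on $X$, respectively. 1. If $X=\mathbb{CP}^1\times\mathbb{CP}^1$, then $\dim_{\mathbb C} H^0(X,\wedge^2T_X)=9$ and $\dim_{\mathbb C} H^0(X,T_X)=6$. 2. If $X=\mathbb{CP}^2$, then $\dim_{\mathbb C} H^0(X,\wedge^2T_X)=10$ and $\dim_{\mathbb C} H^0(X,T_X)=8$. -/

import Mathlib

open scoped Manifold ContDiff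

noncomputable section

/-! ### Complex projective space as a complex manifold -/

/-- Complex projective space `ℂPⁿ`: the complex lines through the origin in `ℂⁿ⁺¹`. -/
def CP (n : ℕ) : Type := Projectivization ℂ (Fin (n + 1) → ℂ)

namespace CP

variable {n : ℕ}

/-- The quotient map `ℂⁿ⁺¹ ∖ {0} → ℂPⁿ`, `(z₀, …, zₙ) ↦ [z₀ : ⋯ : zₙ]`. -/
def proj (v : {v : Fin (n + 1) → ℂ // v ≠ 0}) : CP n := Projectivization.mk ℂ v.1 v.2

/-- The topology on `ℂPⁿ` is the quotient topology. -/
instance : TopologicalSpace (CP n) := TopologicalSpace.coinduced proj inferInstance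

theorem isQuotientMap_proj : Topology.IsQuotientMap (proj (n := n)) :=
  ⟨⟨rfl⟩, fun p => by
    induction p using Projectivization.ind with
    | h v hv => exact ⟨⟨v, hv⟩, rfl⟩⟩

/-- The open set `Uᵢ = {[z] | zᵢ ≠ 0}`. -/
def affineOpen (i : Fin (n + 1)) : Set (CP n) :=
  {p | Projectivization.lift (fun v : {v : Fin (n + 1) → ℂ // v ≠ 0} => v.1 i ≠ 0)
    (fun a b t h => by
      have ht : t ≠ 0 := by
        rintro rfl
        exact a.2 (by rw [h, zero_smul])
      simp [h, ht]) p}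

/-- The affine coordinates `(z_j / z_i)_{j ≠ i}`, with the indices `j ≠ i` in increasing order. -/
def affineCoord (i : Fin (n + 1)) (p : CP n) : Fin n → ℂ :=
  Projectivization.lift
    (fun (v : {v : Fin (n + 1) → ℂ // v ≠ 0}) (j : Fin n) => v.1 (i.succAbove j) / v.1 i)
    (fun a b t h => by
      have ht : t ≠ 0 := by
        rintro rfl
        exact a.2 (by rw [h, zero_smul])
      funext j
      simp [h, mul_div_mul_left _ _ ht]) p

theorem insertNth_ne_zero (i : Fin (n + 1)) (u : Fin n → ℂ) :
    (i.insertNth (1 : ℂ) u : Fin (n + 1) → ℂ) ≠ 0 := fun h => by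
  simpa using congrFun h i

/-- The inverse of the affine coordinates: the point with homogeneous coordinates obtained by
putting `1` in the `i`-th place. -/
def ofAffine (i : Fin (n + 1)) (u : Fin n → ℂ) : CP n :=
  proj ⟨i.insertNth (1 : ℂ) u, insertNth_ne_zero i u⟩

@[simp] theorem proj_mem_affineOpen (i : Fin (n + 1)) (v : {v : Fin (n + 1) → ℂ // v ≠ 0}) :
    proj v ∈ affineOpen i ↔ v.1 i ≠ 0 := Iff.rfl

@[simp] theorem affineCoord_proj (i : Fin (n + 1)) (v : {v : Fin (n + 1) → ℂ // v ≠ 0}) :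
    affineCoord i (proj v) = fun j => v.1 (i.succAbove j) / v.1 i := rfl

theorem isOpen_affineOpen (i : Fin (n + 1)) : IsOpen (affineOpen i : Set (CP n)) := by
  rw [← isQuotientMap_proj.isOpen_preimage]
  have : Continuous fun v : {v : Fin (n + 1) → ℂ // v ≠ 0} => v.1 i :=
    (continuous_apply i).comp continuous_subtype_val
  exact isOpen_ne.preimage this

theorem continuous_insertNth (i : Fin (n + 1)) :
    Continuous fun u : Fin n → ℂ => (i.insertNth (1 : ℂ) u : Fin (n + 1) → ℂ) :=
  Continuous.finInsertNth i continuous_const continuous_id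

/-- The standard affine chart `Uᵢ ≃ ℂⁿ`. -/
def affineChart (i : Fin (n + 1)) : OpenPartialHomeomorph (CP n) (Fin n → ℂ) where
  toFun := affineCoord i
  invFun := ofAffine i
  source := affineOpen i
  target := Set.univ
  map_source' _ _ := Set.mem_univ _
  map_target' u _ := by simp [ofAffine]
  left_inv' p hp := by
    obtain ⟨v, rfl⟩ := isQuotientMap_proj.surjective p
    rw [proj_mem_affineOpen] at hp
    refine (Projectivization.mk_eq_mk_iff' ℂ _ _ _ _).2 ⟨(v.1 i)⁻¹, ?_⟩
    funext k
    refine Fin.succAboveCases i ?_ (fun j => ?_) k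
    · simp [hp]
    · simp [div_eq_inv_mul]
  right_inv' u _ := by
    funext j
    simp [ofAffine]
  open_source := isOpen_affineOpen i
  open_target := isOpen_univ
  continuousOn_toFun := by
    rw [isQuotientMap_proj.continuousOn_isOpen_iff (isOpen_affineOpen i)]
    refine continuousOn_pi.2 fun j => ContinuousOn.div ?_ ?_ fun v hv => hv
    · exact ((continuous_apply _).comp continuous_subtype_val).continuousOn
    · exact ((continuous_apply _).comp continuous_subtype_val).continuousOn
  continuousOn_invFun :=
    (isQuotientMap_proj.continuous.comp ((continuous_insertNth i).subtype_mk _)).continuousOn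

theorem exists_mem_affineOpen (p : CP n) : ∃ i : Fin (n + 1), p ∈ affineOpen i := by
  obtain ⟨v, rfl⟩ := isQuotientMap_proj.surjective p
  exact Function.ne_iff.1 v.2

/-- The atlas of `ℂPⁿ` consists of the `n + 1` standard affine charts. -/
instance : ChartedSpace (Fin n → ℂ) (CP n) where
  atlas := Set.range affineChart
  chartAt p := affineChart (exists_mem_affineOpen p).choose
  mem_chart_source p := (exists_mem_affineOpen p).choose_spec
  chart_mem_atlas _ := Set.mem_range_self _

/-- The transition maps between the affine charts are holomorphic, so `ℂPⁿ` is a complex manifold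
of dimension `n`. -/
instance : IsManifold 𝓘(ℂ, Fin n → ℂ) ω (CP n) := by
  apply isManifold_of_contDiffOn
  rintro _ _ ⟨i, rfl⟩ ⟨j, rfl⟩
  have key : ∀ k : Fin (n + 1), ContDiff ℂ ω
      fun u : Fin n → ℂ => (i.insertNth (1 : ℂ) u : Fin (n + 1) → ℂ) k := fun k => by
    refine Fin.succAboveCases i ?_ (fun l => ?_) k
    · simpa using contDiff_const
    · simpa using contDiff_apply ℂ ℂ l
  refine contDiffOn_pi.2 fun l => ContDiffOn.div (key _).contDiffOn (key _).contDiffOn ?_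
  intro u hu
  exact hu.1.2

end CP

/-! ### Holomorphic vector fields and polyvector fields -/

section Polyvector

variable {E : Type*} [NormedAddCommGroup E] [NormedSpace ℂ E]
  {H : Type*} [TopologicalSpace H] (I : ModelWithCorners ℂ E H)
  (X : Type*) [TopologicalSpace X] [ChartedSpace H X] [IsManifold I ω X]

/-- `H⁰(X, T_X)`: the complex vector space of global holomorphic sections of the holomorphic
tangent bundle of the complex manifold `X`. -/
abbrev HolomorphicVectorField : Type _ :=
  ContMDiffSection I E ω (TangentSpace I : X → Type _)

/-- `H⁰(X, ∧ᵏ T_X)`: the complex vector space of global holomorphic sections of the `k`-th exterior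
power of the holomorphic tangent bundle of the (finite-dimensional) complex manifold `X`.

A section `π` assigns to each `x` an element of `∧ᵏ (T_x X)`. A local trivialization
`T_X|_U ≅ U × E` of the tangent bundle induces a local trivialization `∧ᵏ T_X|_U ≅ U × ∧ᵏ E`,
and `π` is holomorphic when all its coordinates in these local trivializations (that is, its
composites with the linear functionals on `∧ᵏ E`) are holomorphic functions on `U`. -/
def holomorphicPolyvectorField (k : ℕ) :
    Submodule ℂ (∀ x : X, ⋀[ℂ]^k (TangentSpace I x)) where
  carrier := {π | ∀ (x₀ : X) (ℓ : Module.Dual ℂ (⋀[ℂ]^k E)),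
    ContMDiffOn I 𝓘(ℂ, ℂ) ω
      (fun x => ℓ (exteriorPower.map k
        ((trivializationAt E (TangentSpace I : X → Type _) x₀).linearMapAt ℂ x) (π x)))
      (trivializationAt E (TangentSpace I : X → Type _) x₀).baseSet}
  add_mem' := fun h₁ h₂ x₀ ℓ => by
    simp only [Pi.add_apply, map_add]
    exact (h₁ x₀ ℓ).add (h₂ x₀ ℓ)
  zero_mem' := fun x₀ ℓ => by
    simpa only [Pi.zero_apply, map_zero] using contMDiffOn_const
  smul_mem' := fun c π h x₀ ℓ => by
    simp only [Pi.smul_apply, map_smul]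
    exact (contMDiffOn_const (I := I) (I' := 𝓘(ℂ, ℂ)) (c := c)).smul (h x₀ ℓ)

end Polyvector

end

/-! Both spaces consist of sections of a bundle attached to the tangent bundle by a representation
of the endomorphisms of the model space: the standard one for vector fields, the determinant for
bivector fields, because `∧²` of a plane is a line on which a linear map acts by its determinant.
The standard charts are onto the model space, so a section amounts to one entire function per chart,
matched by the coordinate changes (`associatedSectionEquiv`), and the function on one chart
determines the others by density (`compatibleFamily_ext`).

Holomorphy in the other charts bounds the pole at infinity of that one function, and Liouville's
theorem turns the bound into a polynomial (`exists_eq_sum_of_bidegree`,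
`exists_eq_sum_of_totalDegree`).

For bivector fields the determinants are, up to sign, powers of ratios of homogeneous coordinates.
On the plane the exponent is 3, so sections are ternary cubics, with 1 + 2 + 3 + 4 = 10
coefficients; on the product of two lines it is 2 in each factor, so sections are forms of bidegree
(2, 2), with 3 · 3 = 9 coefficients.

Vector fields come from linear fields `z ↦ A z` on `ℂⁿ⁺¹`, which descend to projective space, scalar
matrices giving zero. This yields 9 - 1 = 8 dimensions on the plane and (4 - 1) + (4 - 1) = 6 on the
product; the pole bounds show that there are no other fields. -/

noncomputable section

/-! ### Sections of associated bundles as compatible families of entire functions -/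

section ChartwiseSections

variable {E : Type*} [NormedAddCommGroup E] [NormedSpace ℂ E]
  {H : Type*} [TopologicalSpace H] {I : ModelWithCorners ℂ E H}
  {X : Type*} [TopologicalSpace X] [ChartedSpace H X] [IsManifold I ω X]
  {V : Type*} [NormedAddCommGroup V] [NormedSpace ℂ V]

/-- The base points enter only through their preferred charts, so an arbitrary point may be
exchanged for a fixed one with the same chart. -/
theorem tangentCoordChange_congr {x x' y y' : X} (hx : chartAt H x = chartAt H x')
    (hy : chartAt H y = chartAt H y') :
    tangentCoordChange I x y = tangentCoordChange I x' y' := by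
  have h1 : achart H x = achart H x' := Subtype.ext hx
  have h2 : achart H y = achart H y' := Subtype.ext hy
  unfold tangentCoordChange
  rw [h1, h2]

variable (I X) in
/-- Holomorphic sections of the bundle associated with the tangent bundle of `X` and a
representation `ρ` of the endomorphisms of the model space `E` on `V`; the fibre at `x` is
identified with `V` by the preferred chart at `x`. -/
def associatedSection (ρ : (E →L[ℂ] E) →* Module.End ℂ V) : Submodule ℂ (X → V) where
  carrier := {s | ∀ x₀ : X, ContMDiffOn I 𝓘(ℂ, V) ω
    (fun x => ρ (tangentCoordChange I x x₀ x) (s x)) (chartAt H x₀).source}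
  add_mem' := fun h₁ h₂ x₀ => by
    simp only [Pi.add_apply, map_add]
    exact (h₁ x₀).add (h₂ x₀)
  zero_mem' := fun x₀ => by
    simpa only [Pi.zero_apply, map_zero] using contMDiffOn_const
  smul_mem' := fun c π h x₀ => by
    simp only [Pi.smul_apply, map_smul]
    exact (contMDiffOn_const (I := I) (I' := 𝓘(ℂ, ℂ)) (c := c)).smul (h x₀)

variable (I) in
/-- Families of holomorphic functions on the charts around the points `e i` which are compatible
with the coordinate changes of the bundle associated with `ρ`. -/
def compatibleFamily {ι : Type*} (e : ι → X) (ρ : (E →L[ℂ] E) →* Module.End ℂ V) :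
    Submodule ℂ (ι → E → V) where
  carrier := {F | (∀ i, ContDiff ℂ ω (F i)) ∧
    ∀ (i j : ι) (p : X), p ∈ (chartAt H (e i)).source → p ∈ (chartAt H (e j)).source →
      F j (extChartAt I (e j) p) =
        ρ (tangentCoordChange I (e i) (e j) p) (F i (extChartAt I (e i) p))}
  add_mem' := fun h₁ h₂ => ⟨fun i => (h₁.1 i).add (h₂.1 i), fun i j p hi hj => by
    simp only [Pi.add_apply, map_add, h₁.2 i j p hi hj, h₂.2 i j p hi hj]⟩
  zero_mem' := ⟨fun i => contDiff_const, fun i j p hi hj => by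
    simp only [Pi.zero_apply, map_zero]⟩
  smul_mem' := fun c F h => ⟨fun i => (h.1 i).const_smul c, fun i j p hi hj => by
    simp only [Pi.smul_apply, map_smul, h.2 i j p hi hj]⟩

theorem tangentCoordChange_self_eq_one {x y : X} (h : y ∈ (chartAt H x).source) :
    tangentCoordChange I x x y = 1 := by
  ext v
  exact tangentCoordChange_self (I := I) (by rwa [extChartAt_source])

theorem tangentCoordChange_mul {w x y z : X} (hw : z ∈ (chartAt H w).source)
    (hx : z ∈ (chartAt H x).source) (hy : z ∈ (chartAt H y).source) :
    tangentCoordChange I x y z * tangentCoordChange I w x z = tangentCoordChange I w y z := by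
  ext v
  exact tangentCoordChange_comp (I := I) (by simp only [extChartAt_source]; exact ⟨⟨hw, hx⟩, hy⟩)

/-- When every chart of `X` is one of the charts at the points `e i`, and these are onto `E`, a
holomorphic section is the same as a compatible family of functions on these charts. -/
def associatedSectionEquiv {ι : Type*} (e : ι → X) (c : X → ι)
    (hc : ∀ x, chartAt H x = chartAt H (e (c x)))
    (ht : ∀ i, (extChartAt I (e i)).target = Set.univ)
    (ρ : (E →L[ℂ] E) →* Module.End ℂ V) :
    associatedSection I X ρ ≃ₗ[ℂ] compatibleFamily I e ρ where
  toFun s := ⟨fun i u => ρ (tangentCoordChange I ((extChartAt I (e i)).symm u) (e i)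
      ((extChartAt I (e i)).symm u)) (s.1 ((extChartAt I (e i)).symm u)), by
    have hs : ∀ i u, (extChartAt I (e i)).symm u ∈ (chartAt H (e i)).source := fun i u => by
      rw [← extChartAt_source I]
      exact (extChartAt I (e i)).map_target (by rw [ht]; trivial)
    refine ⟨fun i => ?_, fun i j p hi hj => ?_⟩
    · rw [← contMDiff_iff_contDiff, ← contMDiffOn_univ]
      refine (s.2 (e i)).comp (t := (chartAt H (e i)).source) ?_ fun u _ => hs i u
      have := contMDiffOn_extChartAt_symm (I := I) (n := ω) (e i)
      rwa [ht] at this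
    · simp only
      rw [(extChartAt I (e i)).left_inv (by rwa [extChartAt_source]),
        (extChartAt I (e j)).left_inv (by rwa [extChartAt_source]), ← Module.End.mul_apply,
        ← map_mul, tangentCoordChange_mul (mem_chart_source H p) hi hj]⟩
  map_add' s t := by
    ext; simp
  map_smul' a s := by
    ext; simp
  invFun F := ⟨fun x => F.1 (c x) (extChartAt I (e (c x)) x), fun x₀ => by
    have hx : ∀ x, x ∈ (chartAt H (e (c x))).source := fun x => hc x ▸ mem_chart_source H x
    rw [hc x₀]
    -- The chart index `c x` may jump with `x`, but compatibility rewrites the section, read in the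
    -- chart at `x₀`, through the single function of index `c x₀`.
    refine ContMDiffOn.congr (f := fun x => F.1 (c x₀) (extChartAt I (e (c x₀)) x)) ?_ ?_
    · exact (F.2.1 (c x₀)).contMDiff.comp_contMDiffOn contMDiffOn_extChartAt
    · intro x hxx
      rw [tangentCoordChange_congr (hc x) (hc x₀), F.2.2 (c x) (c x₀) x (hx x) hxx]⟩
  left_inv s := by
    ext x
    have hx : x ∈ (chartAt H (e (c x))).source := hc x ▸ mem_chart_source H x
    simp only
    rw [(extChartAt I (e (c x))).left_inv (by rwa [extChartAt_source]), tangentCoordChange_congr rfl (hc x).symm,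
      tangentCoordChange_self_eq_one (mem_chart_source H x), map_one, Module.End.one_apply]
  right_inv F := by
    ext i u
    have hx : ∀ x, x ∈ (chartAt H (e (c x))).source := fun x => hc x ▸ mem_chart_source H x
    have hs : (extChartAt I (e i)).symm u ∈ (chartAt H (e i)).source := by
      rw [← extChartAt_source I]
      exact (extChartAt I (e i)).map_target (by rw [ht]; trivial)
    simp only
    rw [tangentCoordChange_congr (hc _) rfl, ← F.2.2 _ _ _ (hx _) hs,
      (extChartAt I (e i)).right_inv (by rw [ht]; trivial)]

/-! ### Vector fields and top-degree polyvector fields as associated sections -/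

theorem linearMapAt_trivializationAt_tangentSpace {x₀ x : X}
    (hx : x ∈ (chartAt H x₀).source) :
    (trivializationAt E (TangentSpace I : X → Type _) x₀).linearMapAt ℂ x =
      (tangentCoordChange I x x₀ x : E →ₗ[ℂ] E) :=
  congrArg (fun L : E →L[ℂ] E => (L : E →ₗ[ℂ] E))
    (TangentBundle.continuousLinearMapAt_trivializationAt_eq_core (I := I) hx)

theorem trivializationAt_tangentSpace_snd {x₀ x : X}
    (hx : x ∈ (chartAt H x₀).source) (v : TangentSpace I x) :
    (trivializationAt E (TangentSpace I : X → Type _) x₀ ⟨x, v⟩).2 =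
      tangentCoordChange I x x₀ x v :=
  (congrFun (Bundle.Trivialization.coe_linearMapAt_of_mem (R := ℂ)
    (trivializationAt E (TangentSpace I : X → Type _) x₀) hx) v).symm.trans
    (congrArg (fun L : E →ₗ[ℂ] E => L v) (linearMapAt_trivializationAt_tangentSpace hx))

/-- Holomorphic vector fields as sections of the associated bundle of the standard
representation. -/
def holomorphicVectorFieldEquiv :
    HolomorphicVectorField I X ≃ₗ[ℂ]
      associatedSection I X (ContinuousLinearMap.toLinearMapRingHom : (E →L[ℂ] E) →+* _).toMonoidHom
    where
  toFun s := ⟨fun x => s x, fun x₀ => by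
    have := ((trivializationAt E (TangentSpace I : X → Type _) x₀).contMDiffOn_section_baseSet_iff
      (IB := I) (n := ω) (s := fun x => s x)).1 s.contMDiff.contMDiffOn
    exact this.congr fun x hx => (trivializationAt_tangentSpace_snd hx _).symm⟩
  map_add' s t := rfl
  map_smul' a s := rfl
  invFun s := ⟨fun x => s.1 x, fun x => by
    let t : ∀ x, TangentSpace I x := s.1
    have := ((trivializationAt E (TangentSpace I : X → Type _) x).contMDiffOn_section_baseSet_iff
      (IB := I) (n := ω) (s := t)).2
        ((s.2 x).congr fun y hy => trivializationAt_tangentSpace_snd hy _)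
    exact this.contMDiffAt ((trivializationAt E (TangentSpace I : X → Type _) x).open_baseSet.mem_nhds
      (mem_baseSet_trivializationAt E (TangentSpace I : X → Type _) x))⟩
  left_inv s := rfl
  right_inv s := rfl

/-- The determinant representation. -/
def detRepresentation (E : Type*) [NormedAddCommGroup E] [NormedSpace ℂ E] :
    (E →L[ℂ] E) →* Module.End ℂ ℂ :=
  (Algebra.lmul ℂ ℂ).toMonoidHom.comp (LinearMap.det.comp
    (ContinuousLinearMap.toLinearMapRingHom : (E →L[ℂ] E) →+* _).toMonoidHom)

theorem detRepresentation_apply (L : E →L[ℂ] E) (z : ℂ) :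
    detRepresentation E L z = LinearMap.det (L : E →ₗ[ℂ] E) * z := rfl

/-- The identification of the top exterior power with the scalars by a basis. -/
def topExteriorPowerEquiv {k : ℕ} (b : Module.Basis (Fin k) ℂ E) : ⋀[ℂ]^k E ≃ₗ[ℂ] ℂ :=
  LinearEquiv.ofBijective (exteriorPower.alternatingMapLinearEquiv b.det) (by
    have : Module.Finite ℂ E := .of_basis b
    have h1 : Module.finrank ℂ (⋀[ℂ]^k E) = 1 := by
      rw [exteriorPower.finrank_eq, Module.finrank_eq_card_basis b]; simp
    have hs : Function.Surjective (exteriorPower.alternatingMapLinearEquiv b.det) := fun z =>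
      ⟨z • exteriorPower.ιMulti ℂ k b, by simp [Module.Basis.det_self]⟩
    exact ⟨(LinearMap.injective_iff_surjective_of_finrank_eq_finrank (by simp [h1])).2 hs, hs⟩)

theorem topExteriorPowerEquiv_ιMulti {k : ℕ} (b : Module.Basis (Fin k) ℂ E) (v : Fin k → E) :
    topExteriorPowerEquiv b (exteriorPower.ιMulti ℂ k v) = b.det v :=
  exteriorPower.alternatingMapLinearEquiv_apply_ιMulti _ _

theorem topExteriorPowerEquiv_map {k : ℕ} (b : Module.Basis (Fin k) ℂ E) (L : E →ₗ[ℂ] E)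
    (w : ⋀[ℂ]^k E) :
    topExteriorPowerEquiv b (exteriorPower.map k L w) =
      LinearMap.det L * topExteriorPowerEquiv b w := by
  have : (topExteriorPowerEquiv b).toLinearMap ∘ₗ exteriorPower.map k L =
      LinearMap.det L • (topExteriorPowerEquiv b).toLinearMap := by
    refine exteriorPower.linearMap_ext ?_
    ext v
    simp [topExteriorPowerEquiv_ιMulti, exteriorPower.map_apply_ιMulti, Module.Basis.det_comp]
  exact congrArg (fun f => f w) this

/-- The identification of the top exterior powers of the tangent spaces with the scalars by a
basis of the model space. -/
def tangentTopPowerEquiv {k : ℕ} (b : Module.Basis (Fin k) ℂ E) (x : X) :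
    ⋀[ℂ]^k (TangentSpace I x) ≃ₗ[ℂ] ℂ :=
  topExteriorPowerEquiv (E := E) b

theorem topExteriorPowerEquiv_map_trivializationAt {k : ℕ} (b : Module.Basis (Fin k) ℂ E)
    {x₀ x : X} (hx : x ∈ (chartAt H x₀).source) (w : ⋀[ℂ]^k (TangentSpace I x)) :
    topExteriorPowerEquiv b (exteriorPower.map k
      ((trivializationAt E (TangentSpace I : X → Type _) x₀).linearMapAt ℂ x) w) =
    detRepresentation E (tangentCoordChange I x x₀ x) (tangentTopPowerEquiv b x w) :=
  (congrArg (fun L : TangentSpace I x →ₗ[ℂ] E => topExteriorPowerEquiv b (exteriorPower.map k L w))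
    (linearMapAt_trivializationAt_tangentSpace hx)).trans (topExteriorPowerEquiv_map b _ w)

/-- The top exterior power is a line, so every functional is a multiple of the determinant
coordinate. Holomorphy against all functionals therefore reduces to holomorphy against this one. -/
theorem dual_eq_smul_topExteriorPowerEquiv {k : ℕ} (b : Module.Basis (Fin k) ℂ E)
    (ℓ : Module.Dual ℂ (⋀[ℂ]^k E)) (w : ⋀[ℂ]^k E) :
    ℓ w = ℓ ((topExteriorPowerEquiv b).symm 1) • topExteriorPowerEquiv b w := by
  conv_lhs => rw [← (topExteriorPowerEquiv b).symm_apply_apply w,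
    ← mul_one (topExteriorPowerEquiv b w), ← smul_eq_mul, map_smul, map_smul]
  rw [smul_eq_mul, smul_eq_mul, mul_comm]

/-- Holomorphic polyvector fields of top degree as sections of the associated bundle of the
determinant representation. -/
def holomorphicPolyvectorFieldEquiv {k : ℕ} (b : Module.Basis (Fin k) ℂ E) :
    holomorphicPolyvectorField I X k ≃ₗ[ℂ] associatedSection I X (detRepresentation E) where
  toFun π := ⟨fun x => tangentTopPowerEquiv b x (π.1 x), fun x₀ =>
    (π.2 x₀ (topExteriorPowerEquiv b).toLinearMap).congr fun x hx =>
      (topExteriorPowerEquiv_map_trivializationAt b hx _).symm⟩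
  map_add' s t := Subtype.ext (funext fun x => map_add (tangentTopPowerEquiv b x) (s.1 x) (t.1 x))
  map_smul' a s := Subtype.ext (funext fun x => map_smul (tangentTopPowerEquiv b x) a (s.1 x))
  invFun s := ⟨fun x => (tangentTopPowerEquiv b x).symm (s.1 x), fun x₀ ℓ =>
    ((contMDiffOn_const (I := I) (I' := 𝓘(ℂ, ℂ))
      (c := ℓ ((topExteriorPowerEquiv b).symm 1))).smul (s.2 x₀)).congr fun x hx => by
    refine (dual_eq_smul_topExteriorPowerEquiv b ℓ _).trans ?_
    refine congrArg (ℓ ((topExteriorPowerEquiv b).symm 1) • ·) ?_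
    refine (topExteriorPowerEquiv_map_trivializationAt b hx _).trans ?_
    exact congrArg (detRepresentation E (tangentCoordChange I x x₀ x))
      ((tangentTopPowerEquiv b x).apply_symm_apply (s.1 x))⟩
  left_inv π := Subtype.ext (funext fun x => (tangentTopPowerEquiv b x).symm_apply_apply (π.1 x))
  right_inv s := Subtype.ext (funext fun x => (tangentTopPowerEquiv b x).apply_symm_apply (s.1 x))

/-- A compatible family is determined by its member on a chart with dense domain. -/
theorem compatibleFamily_ext {ι : Type*} {e : ι → X} {ρ : (E →L[ℂ] E) →* Module.End ℂ V}
    (ht : ∀ i, (extChartAt I (e i)).target = Set.univ) (i₀ : ι)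
    (hd : ∀ i, Dense {u : E | (extChartAt I (e i)).symm u ∈ (chartAt H (e i₀)).source})
    {F G : compatibleFamily I e ρ} (h : F.1 i₀ = G.1 i₀) : F = G := by
  ext1
  funext i
  -- On the overlap with the chart `i₀`, which is dense, the member `i` is the transform of the
  -- member `i₀`; continuity does the rest.
  refine Continuous.ext_on (hd i) (F.2.1 i).continuous (G.2.1 i).continuous fun u hu => ?_
  have hs : (extChartAt I (e i)).symm u ∈ (chartAt H (e i)).source := by
    rw [← extChartAt_source I]
    exact (extChartAt I (e i)).map_target (by rw [ht]; trivial)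
  have hF := F.2.2 _ _ _ hu hs
  have hG := G.2.2 _ _ _ hu hs
  rw [(extChartAt I (e i)).right_inv (by rw [ht]; trivial)] at hF hG
  rw [hF, hG, h]

end ChartwiseSections

/-! ### Entire functions with poles of bounded order are polynomials -/

section EntireFunctions

open Filter Topology

/-- Inverting a Vandermonde matrix writes each coefficient as a fixed linear combination of values
of the polynomial. Any linear property of the values in the parameter `y` (vanishing, polynomiality,
holomorphy) thus passes to the coefficients. -/
theorem coeff_mem_of_forall_sum_mem {Y : Type*} (S : Submodule ℂ (Y → ℂ)) {N : ℕ}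
    (a : Fin N → Y → ℂ)
    (h : ∀ x : ℂ, x ≠ 0 → (fun y => ∑ i, a i y * x ^ (i : ℕ)) ∈ S) (i : Fin N) : a i ∈ S := by
  -- The nodes start at 1 because the hypothesis says nothing about `x = 0`.
  set v : Fin N → ℂ := fun k => (k : ℕ) + 1 with hv
  have hv0 : ∀ k, v k ≠ 0 := fun k => by
    simpa [hv] using Nat.cast_add_one_ne_zero (R := ℂ) (k : ℕ)
  have hinj : Function.Injective v := fun k l hkl => by
    simpa [hv, Fin.ext_iff] using hkl
  have hdet : IsUnit (Matrix.vandermonde v).det :=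
    (Matrix.det_vandermonde_ne_zero_iff.2 hinj).isUnit
  have key : a i = ∑ k, (Matrix.vandermonde v)⁻¹ i k • fun y => ∑ l, a l y * v k ^ (l : ℕ) := by
    funext y
    have h1 : (Matrix.vandermonde v)⁻¹.mulVec ((Matrix.vandermonde v).mulVec fun l => a l y) =
        fun l => a l y := by
      rw [Matrix.mulVec_mulVec, Matrix.nonsing_inv_mul _ hdet, Matrix.one_mulVec]
    have h2 := congrFun h1 i
    rw [← h2]
    simp [Matrix.mulVec, dotProduct, Matrix.vandermonde_apply, Finset.sum_apply, mul_comm]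
  rw [key]
  exact S.sum_mem fun k _ => S.smul_mem _ (h _ (hv0 k))

theorem coeff_eq_zero_of_forall_sum_eq_zero {N : ℕ} {a : Fin N → ℂ}
    (h : ∀ x : ℂ, x ≠ 0 → ∑ i, a i * x ^ (i : ℕ) = 0) (i : Fin N) : a i = 0 := by
  have := coeff_mem_of_forall_sum_mem (⊥ : Submodule ℂ (Unit → ℂ)) (fun i _ => a i)
    (fun x hx => by
      rw [Submodule.mem_bot]
      funext _
      exact h x hx) i
  exact congrFun ((Submodule.mem_bot ℂ).1 this) ()

/-- The hypothesis says that `f` has a pole of order at most `k` at infinity. For `k = 0`, `f` has a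
finite limit there and Liouville applies; otherwise `(f x - f 0) / x` is entire with pole order one
less. -/
theorem exists_eq_sum_of_eq_pow_mul_inv (k : ℕ) {f g : ℂ → ℂ} (hf : Differentiable ℂ f)
    (hg : ContinuousAt g 0) (h : ∀ x, x ≠ 0 → f x = x ^ k * g x⁻¹) :
    ∃ a : Fin (k + 1) → ℂ, ∀ x, f x = ∑ i, a i * x ^ (i : ℕ) := by
  induction k generalizing f g with
  | zero =>
    have ht : Tendsto f (cocompact ℂ) (𝓝 (g 0)) := by
      rw [← Metric.cobounded_eq_cocompact]
      have h1 : Tendsto (fun x : ℂ => g x⁻¹) (Bornology.cobounded ℂ) (𝓝 (g 0)) :=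
        hg.tendsto.comp (tendsto_inv₀_cobounded)
      refine h1.congr' ?_
      filter_upwards [Bornology.eventually_ne_cobounded (0 : ℂ)] with x hx
      simp [h x hx]
    refine ⟨fun _ => g 0, fun x => ?_⟩
    simp [hf.apply_eq_of_tendsto_cocompact x ht]
  | succ k ih =>
    have hd : Differentiable ℂ (dslope f 0) := by
      rw [← differentiableOn_univ, Complex.differentiableOn_dslope Filter.univ_mem]
      exact hf.differentiableOn
    -- With `z = x⁻¹`, the term `f 0 / x` equals `x ^ k * (f 0 * z ^ (k + 1))`, whence the new `g`.
    obtain ⟨a, ha⟩ := ih (g := fun z => g z - f 0 * z ^ (k + 1)) hd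
      (hg.sub (by fun_prop)) (fun x hx => by
        rw [dslope_of_ne _ hx, slope_def_field, h x hx, inv_pow]
        field_simp
        ring)
    refine ⟨Fin.cons (f 0) a, fun x => ?_⟩
    rw [Fin.sum_univ_succ]
    have : f x = f 0 + x * dslope f 0 x := by
      have := sub_smul_dslope f 0 x
      rw [sub_zero, smul_eq_mul] at this
      rw [this]; ring
    rw [this, ha, Finset.mul_sum]
    simp [pow_succ]
    exact Finset.sum_congr rfl fun i _ => by ring

/-- The functions `∑ i < k, c i * y ^ i`. -/
def powerSpan (k : ℕ) : Submodule ℂ (ℂ → ℂ) :=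
  LinearMap.range (Fintype.linearCombination ℂ (fun (i : Fin k) (y : ℂ) => y ^ (i : ℕ)))

theorem mem_powerSpan {k : ℕ} {f : ℂ → ℂ} :
    f ∈ powerSpan k ↔ ∃ a : Fin k → ℂ, ∀ x, f x = ∑ i, a i * x ^ (i : ℕ) := by
  simp only [powerSpan, LinearMap.mem_range, Fintype.linearCombination_apply]
  refine exists_congr fun a => ?_
  rw [eq_comm, funext_iff]
  simp [Finset.sum_apply]

/-- A separately entire function with poles of bounded orders at infinity in each variable. -/
theorem exists_eq_sum_of_bidegree (k l : ℕ) {f G K : ℂ → ℂ → ℂ}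
    (hf₁ : ∀ y, Differentiable ℂ fun x => f x y) (hf₂ : ∀ x, Differentiable ℂ fun y => f x y)
    (hG : ∀ y, ContinuousAt (fun a => G a y) 0) (hK : ∀ x, ContinuousAt (fun b => K x b) 0)
    (h₁ : ∀ x y, x ≠ 0 → f x y = x ^ k * G x⁻¹ y)
    (h₂ : ∀ x y, y ≠ 0 → f x y = y ^ l * K x y⁻¹) :
    ∃ c : Fin (k + 1) → Fin (l + 1) → ℂ,
      ∀ x y, f x y = ∑ i, ∑ j, c i j * x ^ (i : ℕ) * y ^ (j : ℕ) := by
  choose a ha using fun y => exists_eq_sum_of_eq_pow_mul_inv k (hf₁ y) (hG y) fun x hx => h₁ x y hx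
  -- For each fixed `x` the function `f x` is a polynomial of degree at most `l`, so the
  -- coefficients in `x` are polynomials in `y` of the same kind.
  have hmem : ∀ i, (fun y => a y i) ∈ powerSpan (l + 1) :=
    coeff_mem_of_forall_sum_mem _ _ fun x _ => by
      rw [mem_powerSpan]
      simp_rw [← ha]
      exact exists_eq_sum_of_eq_pow_mul_inv l (hf₂ x) (hK x) (h₂ x)
  choose c hc using fun i => mem_powerSpan.1 (hmem i)
  refine ⟨c, fun x y => ?_⟩
  rw [ha]
  refine Finset.sum_congr rfl fun i _ => ?_
  rw [hc, Finset.sum_mul]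
  exact Finset.sum_congr rfl fun j _ => by ring

/-- An entire function on the affine plane with a pole of order at most `k` along the line at
infinity of the projective plane. -/
theorem exists_eq_sum_of_totalDegree (k : ℕ) {f G K : ℂ → ℂ → ℂ}
    (hf : Differentiable ℂ fun p : ℂ × ℂ => f p.1 p.2)
    (hG : ∀ s, ContinuousAt (fun a => G a s) 0) (hK : ∀ s, ContinuousAt (fun a => K a s) 0)
    (h₁ : ∀ x y, x ≠ 0 → f x y = x ^ k * G x⁻¹ (y / x))
    (h₂ : ∀ x y, y ≠ 0 → f x y = y ^ k * K y⁻¹ (x / y)) :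
    ∃ c : (n : Fin (k + 1)) → Fin (n + 1) → ℂ,
      ∀ x y, f x y = ∑ n, ∑ m, c n m * x ^ ((n : ℕ) - m) * y ^ (m : ℕ) := by
  -- Restrict to the lines through the origin: `a s` collects the coefficients along `y = s * x`,
  -- and `b s` below those along `x = s * y`.
  choose a ha using fun s => exists_eq_sum_of_eq_pow_mul_inv k (f := fun t => f t (t * s))
    (g := fun r => G r s)
    (hf.comp (f := fun t : ℂ => (t, t * s)) (by fun_prop)) (hG s) fun x hx => by
      rw [h₁ _ _ hx, mul_div_cancel_left₀ _ hx]
  choose b hb using fun s => exists_eq_sum_of_eq_pow_mul_inv k (f := fun t => f (t * s) t)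
    (g := fun r => K r s)
    (hf.comp (f := fun t : ℂ => (t * s, t)) (by fun_prop)) (hK s) fun x hx => by
      rw [h₂ _ _ hx, mul_div_cancel_left₀ _ hx]
  let S : Submodule ℂ (ℂ → ℂ) :=
    { carrier := {g | Differentiable ℂ g}
      add_mem' := fun h₁ h₂ => Differentiable.add h₁ h₂
      zero_mem' := differentiable_const 0
      smul_mem' := fun c g hg => Differentiable.const_smul hg c }
  have haS : ∀ i, Differentiable ℂ fun s => a s i :=
    coeff_mem_of_forall_sum_mem S _ fun t _ => by
      simp_rw [← ha]
      exact hf.comp (f := fun s : ℂ => (t, t * s)) (by fun_prop)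
  have hbS : ∀ i, Differentiable ℂ fun s => b s i :=
    coeff_mem_of_forall_sum_mem S _ fun t _ => by
      simp_rw [← hb]
      exact hf.comp (f := fun s : ℂ => (t * s, t)) (by fun_prop)
  -- For `s ≠ 0` the slopes `s` and `s⁻¹` describe the same line, with parameters `t` and `t * s`.
  -- Comparing coefficients bounds the pole of `a · n` at infinity by `n`, so it is a polynomial of
  -- degree at most `n` in the slope.
  have hab : ∀ n s, s ≠ 0 → a s n = s ^ (n : ℕ) * b s⁻¹ n := fun n s hs => by
    rw [← sub_eq_zero]
    refine coeff_eq_zero_of_forall_sum_eq_zero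
      (a := fun n : Fin (k + 1) => a s n - s ^ (n : ℕ) * b s⁻¹ n) (fun t _ => ?_) n
    have h := hb s⁻¹ (t * s)
    simp only [mul_inv_cancel_right₀ hs, ha s t] at h
    simp only [sub_mul, Finset.sum_sub_distrib, h, sub_eq_zero]
    exact Finset.sum_congr rfl fun i _ => by ring
  choose c hc using fun n : Fin (k + 1) =>
    exists_eq_sum_of_eq_pow_mul_inv (n : ℕ) (haS n) (hbS n).continuous.continuousAt (hab n)
  have hx : ∀ x y, x ≠ 0 → f x y = ∑ n, ∑ m, c n m * x ^ ((n : ℕ) - m) * y ^ (m : ℕ) := by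
    intro x y hx
    have h := ha (y / x) x
    simp only [mul_div_cancel₀ _ hx] at h
    rw [h]
    refine Finset.sum_congr rfl fun n _ => ?_
    rw [hc, Finset.sum_mul]
    refine Finset.sum_congr rfl fun m _ => ?_
    rw [pow_sub₀ _ hx (Nat.lt_succ_iff.1 m.2), div_pow]
    ring
  -- The slope `y / x` is unavailable at `x = 0`; continuity in `x` fills the gap.
  refine ⟨c, fun x y => ?_⟩
  have hc1 : Continuous fun x => f x y :=
    hf.continuous.comp (f := fun x : ℂ => (x, y)) (by fun_prop)
  exact congrFun (Continuous.ext_on (dense_compl_singleton (0 : ℂ)) hc1 (by fun_prop)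
    fun x h => hx x y h) x

theorem bidegree_coeff_eq_zero {k l : ℕ} {c : Fin k → Fin l → ℂ}
    (h : ∀ x y : ℂ, ∑ i, ∑ j, c i j * x ^ (i : ℕ) * y ^ (j : ℕ) = 0) (i : Fin k) (j : Fin l) :
    c i j = 0 := by
  refine coeff_eq_zero_of_forall_sum_eq_zero (fun y _ => ?_) j
  refine coeff_eq_zero_of_forall_sum_eq_zero
    (a := fun i => ∑ j, c i j * y ^ (j : ℕ)) (fun x _ => ?_) i
  rw [← h x y]
  refine Finset.sum_congr rfl fun i _ => ?_
  rw [Finset.sum_mul]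
  exact Finset.sum_congr rfl fun j _ => by ring

/-- On `y = t * s` the sum is a polynomial in `t` whose `n`-th coefficient is the polynomial in `s`
with coefficients `c n m`. -/
theorem totalDegree_coeff_eq_zero {k : ℕ} {c : (n : Fin k) → Fin (n + 1) → ℂ}
    (h : ∀ x y : ℂ, ∑ n, ∑ m, c n m * x ^ ((n : ℕ) - m) * y ^ (m : ℕ) = 0) (n : Fin k)
    (m : Fin (n + 1)) : c n m = 0 := by
  refine coeff_eq_zero_of_forall_sum_eq_zero (fun s _ => ?_) m
  refine coeff_eq_zero_of_forall_sum_eq_zero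
    (a := fun n => ∑ m, c n m * s ^ (m : ℕ)) (fun t ht => ?_) n
  rw [← h t (t * s)]
  refine Finset.sum_congr rfl fun n _ => ?_
  rw [Finset.sum_mul]
  refine Finset.sum_congr rfl fun m _ => ?_
  rw [pow_sub₀ _ ht (Nat.lt_succ_iff.1 m.2), mul_pow]
  field_simp

end EntireFunctions

/-! ### Affine charts of projective space and their coordinate changes -/

namespace CP

variable {n : ℕ}

/-- The coordinate points `[0 : ⋯ : 1 : ⋯ : 0]`. -/
def coordPoint (i : Fin (n + 1)) : CP n := proj ⟨Pi.single i 1, by simp⟩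

theorem chartAt_eq (p : CP n) :
    chartAt (Fin n → ℂ) p = affineChart (exists_mem_affineOpen p).choose := rfl

/-- Preferred charts are chosen arbitrarily, but a coordinate point lies in only one affine open
set, which forces the choice. -/
theorem chartAt_coordPoint (i : Fin (n + 1)) :
    chartAt (Fin n → ℂ) (coordPoint i) = affineChart i := by
  have h := (exists_mem_affineOpen (coordPoint i)).choose_spec
  rw [chartAt_eq]
  congr 1
  by_contra hne
  exact h (Pi.single_eq_of_ne hne _)

theorem exists_chartAt_eq (p : CP n) :
    ∃ i : Fin (n + 1), chartAt (Fin n → ℂ) p = chartAt (Fin n → ℂ) (coordPoint i) :=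
  ⟨_, by rw [chartAt_coordPoint]; exact chartAt_eq p⟩

theorem extChartAt_coordPoint (i : Fin (n + 1)) :
    extChartAt 𝓘(ℂ, Fin n → ℂ) (coordPoint i) = (affineChart i).toPartialEquiv := by
  simp [extChartAt, OpenPartialHomeomorph.extend, chartAt_coordPoint]

theorem coe_extChartAt_coordPoint (i : Fin (n + 1)) :
    ⇑(extChartAt 𝓘(ℂ, Fin n → ℂ) (coordPoint i)) = affineCoord i := by
  rw [extChartAt_coordPoint]; rfl

theorem coe_extChartAt_coordPoint_symm (i : Fin (n + 1)) :
    ⇑(extChartAt 𝓘(ℂ, Fin n → ℂ) (coordPoint i)).symm = ofAffine i := by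
  rw [extChartAt_coordPoint]; rfl

theorem extChartAt_coordPoint_target (i : Fin (n + 1)) :
    (extChartAt 𝓘(ℂ, Fin n → ℂ) (coordPoint i)).target = Set.univ := by
  rw [extChartAt_coordPoint]; rfl

theorem chartAt_coordPoint_source (i : Fin (n + 1)) :
    (chartAt (Fin n → ℂ) (coordPoint i)).source = affineOpen i := by
  rw [chartAt_coordPoint]; rfl

theorem dense_ofAffine_mem_affineOpen (i j : Fin (n + 1)) :
    Dense {u : Fin n → ℂ | ofAffine i u ∈ affineOpen j} := by
  refine Fin.succAboveCases i ?_ (fun l => ?_) j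
  · simp [ofAffine]
  · have : {u : Fin n → ℂ | ofAffine i u ∈ affineOpen (i.succAbove l)} =
        (fun u => u l) ⁻¹' {0}ᶜ := by
      ext u
      simp [ofAffine]
    rw [this]
    exact (dense_compl_singleton (0 : ℂ)).preimage (isOpenMap_eval l)

/-- The derivative at `z` in the direction `w` of the affine coordinates
`(z_j / z_i)_{j ≠ i}`. -/
def affineDeriv (i : Fin (n + 1)) (z w : Fin (n + 1) → ℂ) : Fin n → ℂ := fun l =>
  (w (i.succAbove l) * z i - z (i.succAbove l) * w i) / z i ^ 2

theorem affineDeriv_smul_smul (i : Fin (n + 1)) {c : ℂ} (hc : c ≠ 0) (z w : Fin (n + 1) → ℂ) :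
    affineDeriv i (c • z) (c • w) = affineDeriv i z w := by
  funext l
  simp only [affineDeriv, Pi.smul_apply, smul_eq_mul]
  rw [← mul_div_mul_left (w (i.succAbove l) * z i - _) _ (pow_ne_zero 2 hc)]
  congr 1 <;> ring

theorem insertNth_affineCoord (i : Fin (n + 1)) (v : {v : Fin (n + 1) → ℂ // v ≠ 0})
    (hi : v.1 i ≠ 0) :
    (i.insertNth (1 : ℂ) (affineCoord i (proj v)) : Fin (n + 1) → ℂ) = (v.1 i)⁻¹ • v.1 := by
  funext k
  refine Fin.succAboveCases i ?_ (fun l => ?_) k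
  · simp [hi]
  · simp [div_eq_inv_mul]

/-- A line in chart `i` with direction `h` lifts to a line in `ℂⁿ⁺¹` with direction `h` extended by
0 in place `i`. The coordinates in chart `j` are quotients of linear functions along it, and the
quotient rule gives the formula. -/
theorem tangentCoordChange_apply (i j : Fin (n + 1)) (v : {v : Fin (n + 1) → ℂ // v ≠ 0})
    (hi : v.1 i ≠ 0) (hj : v.1 j ≠ 0) (h : Fin n → ℂ) :
    tangentCoordChange 𝓘(ℂ, Fin n → ℂ) (coordPoint i) (coordPoint j) (proj v) h =
      affineDeriv j ((v.1 i)⁻¹ • v.1) (i.insertNth (0 : ℂ) h) := by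
  have h1 := hasFDerivWithinAt_tangentCoordChange (I := 𝓘(ℂ, Fin n → ℂ)) (x := coordPoint i)
    (y := coordPoint j) (z := proj v) (by
      rw [extChartAt_source, extChartAt_source, chartAt_coordPoint_source,
        chartAt_coordPoint_source]
      exact ⟨hi, hj⟩)
  rw [modelWithCornersSelf_coe, Set.range_id, hasFDerivWithinAt_univ, coe_extChartAt_coordPoint,
    coe_extChartAt_coordPoint, coe_extChartAt_coordPoint_symm] at h1
  have h2 := (h1.hasLineDerivAt h)
  unfold HasLineDerivAt at h2
  refine h2.unique ?_
  set u := affineCoord i (proj v) with hu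
  have hz : (v.1 i)⁻¹ • v.1 = i.insertNth (1 : ℂ) u := (insertNth_affineCoord i v hi).symm
  have hins : ∀ t : ℂ, (i.insertNth (1 : ℂ) (u + t • h) : Fin (n + 1) → ℂ) =
      (v.1 i)⁻¹ • v.1 + t • i.insertNth (0 : ℂ) h := fun t => by
    rw [hz]
    funext k
    refine Fin.succAboveCases i ?_ (fun l => ?_) k <;> simp
  rw [hasDerivAt_pi]
  intro l
  have hform : (fun t : ℂ => (affineCoord j ∘ ofAffine i) (u + t • h) l) = fun t : ℂ =>
      (((v.1 i)⁻¹ • v.1) (j.succAbove l) + t * (i.insertNth (0 : ℂ) h : Fin (n + 1) → ℂ)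
        (j.succAbove l)) /
      (((v.1 i)⁻¹ • v.1) j + t * (i.insertNth (0 : ℂ) h : Fin (n + 1) → ℂ) j) := by
    funext t
    simp only [Function.comp_apply, ofAffine, affineCoord_proj, hins]
    rfl
  rw [hform]
  have hd : ∀ k, HasDerivAt (fun t : ℂ => ((v.1 i)⁻¹ • v.1) k +
      t * (i.insertNth (0 : ℂ) h : Fin (n + 1) → ℂ) k)
      ((i.insertNth (0 : ℂ) h : Fin (n + 1) → ℂ) k) 0 := fun k => by
    simpa using ((hasDerivAt_id' (0 : ℂ)).mul_const
      ((i.insertNth (0 : ℂ) h : Fin (n + 1) → ℂ) k)).const_add (((v.1 i)⁻¹ • v.1) k)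
  have := (hd (j.succAbove l)).div (hd j) (by simp [hi, hj])
  simp only [zero_mul, add_zero] at this
  exact this

/-- Both chart vectors represent the image of `w` under the differential of the quotient map at `v`.
Concretely, lifting the vector of chart `i` gives `w / v i` up to a multiple of `v`, which
`affineDeriv j` kills. -/
theorem tangentCoordChange_affineDeriv (i j : Fin (n + 1)) (v : {v : Fin (n + 1) → ℂ // v ≠ 0})
    (hi : v.1 i ≠ 0) (hj : v.1 j ≠ 0) (w : Fin (n + 1) → ℂ) :
    tangentCoordChange 𝓘(ℂ, Fin n → ℂ) (coordPoint i) (coordPoint j) (proj v)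
      (affineDeriv i v.1 w) = affineDeriv j v.1 w := by
  have hins : (i.insertNth (0 : ℂ) (affineDeriv i v.1 w) : Fin (n + 1) → ℂ) =
      fun k => (w k * v.1 i - v.1 k * w i) / v.1 i ^ 2 := by
    funext k
    refine Fin.succAboveCases i ?_ (fun l => ?_) k
    · simp [mul_comm]
    · simp [affineDeriv]
  rw [tangentCoordChange_apply i j v hi hj, hins]
  funext l
  simp only [affineDeriv, Pi.smul_apply, smul_eq_mul]
  field_simp
  ring

/-- The exponent shows that the top power of the tangent bundle is `O(2)` here and `O(3)` for the
plane below. The signs come from ordering the affine coordinates increasingly; they form a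
coboundary. -/
theorem det_tangentCoordChange_one (i j : Fin 2) (v : {v : Fin 2 → ℂ // v ≠ 0})
    (hi : v.1 i ≠ 0) (hj : v.1 j ≠ 0) :
    LinearMap.det (tangentCoordChange 𝓘(ℂ, Fin 1 → ℂ) (coordPoint i) (coordPoint j) (proj v) :
      (Fin 1 → ℂ) →ₗ[ℂ] (Fin 1 → ℂ)) =
      (-1) ^ (i : ℕ) * (-1) ^ (j : ℕ) * (v.1 i / v.1 j) ^ 2 := by
  rw [← LinearMap.det_toMatrix', Matrix.det_fin_one, LinearMap.toMatrix'_apply]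
  simp only [ContinuousLinearMap.coe_coe]
  rw [tangentCoordChange_apply i j v hi hj]
  fin_cases i <;> fin_cases j <;>
    simp [affineDeriv, Fin.succAbove, Fin.insertNth, Fin.succAboveCases] at hi hj ⊢ <;> field_simp

theorem det_tangentCoordChange_two (i j : Fin 3) (v : {v : Fin 3 → ℂ // v ≠ 0})
    (hi : v.1 i ≠ 0) (hj : v.1 j ≠ 0) :
    LinearMap.det (tangentCoordChange 𝓘(ℂ, Fin 2 → ℂ) (coordPoint i) (coordPoint j) (proj v) :
      (Fin 2 → ℂ) →ₗ[ℂ] (Fin 2 → ℂ)) =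
      (-1) ^ (i : ℕ) * (-1) ^ (j : ℕ) * (v.1 i / v.1 j) ^ 3 := by
  rw [← LinearMap.det_toMatrix', Matrix.det_fin_two]
  simp only [LinearMap.toMatrix'_apply, ContinuousLinearMap.coe_coe]
  simp only [tangentCoordChange_apply i j v hi hj]
  fin_cases i <;> fin_cases j <;>
    simp [affineDeriv, Fin.succAbove, Fin.insertNth, Fin.succAboveCases] at hi hj ⊢ <;> field_simp

end CP

/-! ### Coordinate changes on a product manifold -/

section Product

theorem HasFDerivWithinAt.fderivWithin_prodMap {E F E' F' : Type*}
    [NormedAddCommGroup E] [NormedSpace ℂ E] [NormedAddCommGroup F] [NormedSpace ℂ F]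
    [NormedAddCommGroup E'] [NormedSpace ℂ E'] [NormedAddCommGroup F'] [NormedSpace ℂ F']
    {f : E → F} {f' : E →L[ℂ] F} {g : E' → F'} {g' : E' →L[ℂ] F'} {s : Set E} {t : Set E'}
    {a : E} {b : E'} (hf : HasFDerivWithinAt f f' s a) (hg : HasFDerivWithinAt g g' t b)
    (hs : UniqueDiffWithinAt ℂ s a) (ht : UniqueDiffWithinAt ℂ t b) :
    fderivWithin ℂ (Prod.map f g) (s ×ˢ t) (a, b) = f'.prodMap g' :=
  (HasFDerivWithinAt.prodMap (s := s ×ˢ t) (p := (a, b))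
    (hf.mono (Set.fst_image_prod_subset s t)) (hg.mono (Set.snd_image_prod_subset s t))).fderivWithin
    (hs.prod ht)

variable {E : Type*} [NormedAddCommGroup E] [NormedSpace ℂ E]
  {H : Type*} [TopologicalSpace H] {I : ModelWithCorners ℂ E H}
  {X : Type*} [TopologicalSpace X] [ChartedSpace H X] [IsManifold I ω X]
  {E' : Type*} [NormedAddCommGroup E'] [NormedSpace ℂ E']
  {H' : Type*} [TopologicalSpace H'] {I' : ModelWithCorners ℂ E' H'}
  {X' : Type*} [TopologicalSpace X'] [ChartedSpace H' X'] [IsManifold I' ω X']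

theorem tangentCoordChange_prod {x y z : X} {x' y' z' : X'} (hx : z ∈ (chartAt H x).source)
    (hy : z ∈ (chartAt H y).source) (hx' : z' ∈ (chartAt H' x').source)
    (hy' : z' ∈ (chartAt H' y').source) :
    tangentCoordChange (I.prod I') (x, x') (y, y') (z, z') =
      (tangentCoordChange I x y z).prodMap (tangentCoordChange I' x' y' z') := by
  have h := hasFDerivWithinAt_tangentCoordChange (I := I) (x := x) (y := y) (z := z)
    (by simp only [extChartAt_source]; exact ⟨hx, hy⟩)
  have h' := hasFDerivWithinAt_tangentCoordChange (I := I') (x := x') (y := y') (z := z')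
    (by simp only [extChartAt_source]; exact ⟨hx', hy'⟩)
  have h3 := h.fderivWithin_prodMap h' (I.uniqueDiffOn _ ⟨_, rfl⟩) (I'.uniqueDiffOn _ ⟨_, rfl⟩)
  have hr : Set.range (I.prod I') = Set.range I ×ˢ Set.range I' := by
    rw [modelWithCorners_prod_coe, Set.range_prodMap]
  rw [← hr] at h3
  rw [tangentCoordChange_def, ← h3]
  congr 1

end Product

/-! ### Sections over projective space and linear vector fields -/

namespace CP

variable {n : ℕ}

theorem contDiff_insertNth (i : Fin (n + 1)) (k : Fin (n + 1)) :
    ContDiff ℂ ω fun u : Fin n → ℂ => (i.insertNth (1 : ℂ) u : Fin (n + 1) → ℂ) k := by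
  refine Fin.succAboveCases i ?_ (fun l => ?_) k
  · simpa using contDiff_const
  · simpa using contDiff_apply ℂ ℂ l

/-- Sections over projective space as compatible families on the standard affine charts. -/
def sectionEquiv {V : Type*} [NormedAddCommGroup V] [NormedSpace ℂ V]
    (ρ : ((Fin n → ℂ) →L[ℂ] (Fin n → ℂ)) →* Module.End ℂ V) :
    associatedSection 𝓘(ℂ, Fin n → ℂ) (CP n) ρ ≃ₗ[ℂ]
      compatibleFamily 𝓘(ℂ, Fin n → ℂ) (coordPoint (n := n)) ρ :=
  associatedSectionEquiv coordPoint (fun p => (exists_chartAt_eq p).choose)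
    (fun p => (exists_chartAt_eq p).choose_spec) extChartAt_coordPoint_target ρ

theorem mem_compatibleFamily_iff {V : Type*} [NormedAddCommGroup V] [NormedSpace ℂ V]
    (ρ : ((Fin n → ℂ) →L[ℂ] (Fin n → ℂ)) →* Module.End ℂ V)
    (F : Fin (n + 1) → (Fin n → ℂ) → V) :
    F ∈ compatibleFamily 𝓘(ℂ, Fin n → ℂ) (coordPoint (n := n)) ρ ↔
      (∀ i, ContDiff ℂ ω (F i)) ∧ ∀ (i j : Fin (n + 1)) (v : {v : Fin (n + 1) → ℂ // v ≠ 0}),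
        v.1 i ≠ 0 → v.1 j ≠ 0 → F j (affineCoord j (proj v)) =
          ρ (tangentCoordChange 𝓘(ℂ, Fin n → ℂ) (coordPoint i) (coordPoint j) (proj v))
            (F i (affineCoord i (proj v))) := by
  refine and_congr Iff.rfl (forall₂_congr fun i j => ?_)
  simp only [chartAt_coordPoint_source, coe_extChartAt_coordPoint]
  rw [isQuotientMap_proj.surjective.forall]
  rfl

theorem compatibleFamily_ext_zero {V : Type*} [NormedAddCommGroup V] [NormedSpace ℂ V]
    {ρ : ((Fin n → ℂ) →L[ℂ] (Fin n → ℂ)) →* Module.End ℂ V}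
    {F G : compatibleFamily 𝓘(ℂ, Fin n → ℂ) (coordPoint (n := n)) ρ} (h : F.1 0 = G.1 0) :
    F = G :=
  compatibleFamily_ext extChartAt_coordPoint_target 0 (fun i => by
    rw [coe_extChartAt_coordPoint_symm, chartAt_coordPoint_source]
    exact dense_ofAffine_mem_affineOpen i 0) h

/-- The linear vector field of the matrix `A` in the `i`-th affine chart. -/
def linearFieldInChart (A : Matrix (Fin (n + 1)) (Fin (n + 1)) ℂ) (i : Fin (n + 1))
    (u : Fin n → ℂ) : Fin n → ℂ :=
  affineDeriv i (i.insertNth (1 : ℂ) u) (A.mulVec (i.insertNth (1 : ℂ) u))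

theorem contDiff_linearFieldInChart (A : Matrix (Fin (n + 1)) (Fin (n + 1)) ℂ)
    (i : Fin (n + 1)) : ContDiff ℂ ω (linearFieldInChart A i) := by
  have h : ∀ k, ContDiff ℂ ω fun u : Fin n → ℂ =>
      ∑ l, A k l * (i.insertNth (1 : ℂ) u : Fin (n + 1) → ℂ) l := fun k =>
    ContDiff.sum fun l _ => contDiff_const.mul (contDiff_insertNth i l)
  refine contDiff_pi.2 fun l => ?_
  simp only [linearFieldInChart, affineDeriv, Fin.insertNth_apply_same, one_pow, div_one]
  simpa [Matrix.mulVec, dotProduct] using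
    (h (i.succAbove l)).sub ((contDiff_insertNth i (i.succAbove l)).mul (h i))

theorem linearFieldInChart_affineCoord (A : Matrix (Fin (n + 1)) (Fin (n + 1)) ℂ)
    (i : Fin (n + 1)) (v : {v : Fin (n + 1) → ℂ // v ≠ 0}) (hi : v.1 i ≠ 0) :
    linearFieldInChart A i (affineCoord i (proj v)) = affineDeriv i v.1 (A.mulVec v.1) := by
  rw [linearFieldInChart, insertNth_affineCoord i v hi, Matrix.mulVec_smul,
    affineDeriv_smul_smul i (inv_ne_zero hi)]

/-- In every chart the field is the image of the same vector `A v` at `v`, since the linear field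
scales together with its base point. -/
theorem tangentCoordChange_linearFieldInChart (A : Matrix (Fin (n + 1)) (Fin (n + 1)) ℂ)
    (i j : Fin (n + 1)) (v : {v : Fin (n + 1) → ℂ // v ≠ 0}) (hi : v.1 i ≠ 0) (hj : v.1 j ≠ 0) :
    tangentCoordChange 𝓘(ℂ, Fin n → ℂ) (coordPoint i) (coordPoint j) (proj v)
      (linearFieldInChart A i (affineCoord i (proj v))) =
    linearFieldInChart A j (affineCoord j (proj v)) := by
  rw [linearFieldInChart_affineCoord A i v hi, linearFieldInChart_affineCoord A j v hj,
    tangentCoordChange_affineDeriv i j v hi hj]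

theorem linearFieldInChart_add (A B : Matrix (Fin (n + 1)) (Fin (n + 1)) ℂ) (i : Fin (n + 1))
    (u : Fin n → ℂ) :
    linearFieldInChart (A + B) i u = linearFieldInChart A i u + linearFieldInChart B i u := by
  funext l
  simp only [linearFieldInChart, affineDeriv, Matrix.add_mulVec, Pi.add_apply]
  ring

theorem linearFieldInChart_smul (c : ℂ) (A : Matrix (Fin (n + 1)) (Fin (n + 1)) ℂ)
    (i : Fin (n + 1)) (u : Fin n → ℂ) :
    linearFieldInChart (c • A) i u = c • linearFieldInChart A i u := by
  funext l
  simp only [linearFieldInChart, affineDeriv, Matrix.smul_mulVec, Pi.smul_apply, smul_eq_mul]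
  ring

/-! ### The projective plane -/

section Plane

theorem differentiable_vec_two : Differentiable ℂ fun p : ℂ × ℂ => ![p.1, p.2] := by
  rw [differentiable_pi]
  intro l
  fin_cases l
  · exact differentiable_fst
  · exact differentiable_snd

theorem finCons_two (a : ℂ) (g : Fin 2 → ℂ) : (Fin.cons a g : Fin 3 → ℂ) 2 = g 1 := rfl

/-- The vector `(1, x, y)`. -/
def planeVec (x y : ℂ) : {v : Fin 3 → ℂ // v ≠ 0} :=
  ⟨![1, x, y], fun h => one_ne_zero (congrFun h 0)⟩

theorem affineCoord_planeVec_zero (x y : ℂ) : affineCoord 0 (proj (planeVec x y)) = ![x, y] := by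
  funext l; fin_cases l <;> simp [planeVec]

theorem affineCoord_planeVec_one (x y : ℂ) :
    affineCoord 1 (proj (planeVec x y)) = ![x⁻¹, y / x] := by
  funext l; fin_cases l <;> simp [planeVec, Fin.succAbove]

theorem affineCoord_planeVec_two (x y : ℂ) :
    affineCoord 2 (proj (planeVec x y)) = ![y⁻¹, x / y] := by
  funext l; fin_cases l <;> simp [planeVec, Fin.succAbove]

/-- The ternary form of degree `k` with coefficients `c`. -/
def ternaryForm (k : ℕ) (c : (Σ i : Fin (k + 1), Fin (i + 1)) → ℂ) (z : Fin 3 → ℂ) : ℂ :=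
  ∑ i : Fin (k + 1), ∑ m : Fin (i + 1),
    c ⟨i, m⟩ * z 0 ^ (k - i) * z 1 ^ ((i : ℕ) - m) * z 2 ^ (m : ℕ)

theorem ternaryForm_smul (k : ℕ) (c : (Σ i : Fin (k + 1), Fin (i + 1)) → ℂ) (t : ℂ)
    (z : Fin 3 → ℂ) : ternaryForm k c (t • z) = t ^ k * ternaryForm k c z := by
  simp only [ternaryForm, Finset.mul_sum]
  refine Finset.sum_congr rfl fun i _ => Finset.sum_congr rfl fun m _ => ?_
  have : t ^ k = t ^ (k - i) * t ^ ((i : ℕ) - m) * t ^ (m : ℕ) := by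
    rw [← pow_add, ← pow_add]; congr 1; omega
  simp only [Pi.smul_apply, smul_eq_mul, mul_pow, this]
  ring

theorem ternaryForm_insertNth_zero (k : ℕ) (c : (Σ i : Fin (k + 1), Fin (i + 1)) → ℂ)
    (u : Fin 2 → ℂ) : ternaryForm k c ((0 : Fin 3).insertNth (1 : ℂ) u) =
      ∑ i : Fin (k + 1), ∑ m : Fin (i + 1), c ⟨i, m⟩ * u 0 ^ ((i : ℕ) - m) * u 1 ^ (m : ℕ) := by
  simp [ternaryForm, Fin.insertNth_zero']
  rfl

/-- The bivector field on the projective plane of a ternary cubic form. -/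
def cubicBivectorFamily : ((Σ i : Fin 4, Fin (i + 1)) → ℂ) →ₗ[ℂ]
    compatibleFamily 𝓘(ℂ, Fin 2 → ℂ) (coordPoint (n := 2)) (detRepresentation (Fin 2 → ℂ)) where
  -- Degree 3 matches the exponent in `det_tangentCoordChange_two`, and the factor `(-1) ^ i`
  -- absorbs its signs.
  toFun c := ⟨fun i u => (-1) ^ (i : ℕ) * ternaryForm 3 c (i.insertNth (1 : ℂ) u), by
    rw [mem_compatibleFamily_iff]
    refine ⟨fun i => contDiff_const.mul ?_, fun i j v hi hj => ?_⟩
    · exact ContDiff.sum fun k _ => ContDiff.sum fun m _ =>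
        ((contDiff_const.mul ((contDiff_insertNth i 0).pow _)).mul
          ((contDiff_insertNth i 1).pow _)).mul ((contDiff_insertNth i 2).pow _)
    · rw [detRepresentation_apply, det_tangentCoordChange_two i j v hi hj,
        insertNth_affineCoord i v hi, insertNth_affineCoord j v hj, ternaryForm_smul,
        ternaryForm_smul]
      have : ((-1 : ℂ) ^ (i : ℕ)) ^ 2 = 1 := by rw [← pow_mul, mul_comm, pow_mul]; simp
      field_simp
      rw [this, mul_one]⟩
  map_add' c d := by
    ext i u
    simp only [ternaryForm, Pi.add_apply, add_mul, Finset.sum_add_distrib, mul_add,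
      Submodule.coe_add]
  map_smul' a c := by
    ext i u
    simp only [ternaryForm, Pi.smul_apply, smul_eq_mul, RingHom.id_apply, Submodule.coe_smul,
      Finset.mul_sum]
    refine Finset.sum_congr rfl fun i _ => Finset.sum_congr rfl fun m _ => ?_
    ring

theorem cubicBivectorFamily_zero (c : (Σ i : Fin 4, Fin (i + 1)) → ℂ) (u : Fin 2 → ℂ) :
    (cubicBivectorFamily c).1 0 u =
      ∑ i : Fin 4, ∑ m : Fin (i + 1), c ⟨i, m⟩ * u 0 ^ ((i : ℕ) - m) * u 1 ^ (m : ℕ) := by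
  rw [← ternaryForm_insertNth_zero]
  simp [cubicBivectorFamily]

/-- In chart 0 a cubic form becomes an arbitrary polynomial of degree at most 3. Conversely, the
determinants to charts 1 and 2 bound the pole along the line at infinity by 3. -/
theorem cubicBivectorFamily_bijective : Function.Bijective cubicBivectorFamily := by
  constructor
  · rw [injective_iff_map_eq_zero]
    intro c hc
    funext ⟨i, m⟩
    refine totalDegree_coeff_eq_zero (c := fun i m => c ⟨i, m⟩) (fun x y => ?_) i m
    have := cubicBivectorFamily_zero c ![x, y]
    rw [hc] at this
    exact this.symm
  · intro F
    have hF := (mem_compatibleFamily_iff _ _).1 F.2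
    have hcont : ∀ i s, ContinuousAt (fun a => F.1 i ![a, s]) 0 := fun i s =>
      ((hF.1 i).continuous.comp (f := fun a : ℂ => ![a, s]) (by fun_prop)).continuousAt
    obtain ⟨c, hc⟩ := exists_eq_sum_of_totalDegree 3 (f := fun x y => F.1 0 ![x, y])
      (G := fun a s => -F.1 1 ![a, s]) (K := fun a s => F.1 2 ![a, s])
      (((hF.1 0).differentiable (by simp)).comp (f := fun p : ℂ × ℂ => ![p.1, p.2])
        differentiable_vec_two)
      (fun s => (hcont 1 s).neg) (hcont 2) (fun x y hx => by
        have h := hF.2 0 1 (planeVec x y) one_ne_zero hx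
        rw [detRepresentation_apply, det_tangentCoordChange_two 0 1 _ one_ne_zero hx,
          affineCoord_planeVec_zero, affineCoord_planeVec_one] at h
        rw [h]
        simp [planeVec]
        field_simp) (fun x y hy => by
        have h := hF.2 0 2 (planeVec x y) one_ne_zero hy
        rw [detRepresentation_apply, det_tangentCoordChange_two 0 2 _ one_ne_zero hy,
          affineCoord_planeVec_zero, affineCoord_planeVec_two] at h
        rw [h]
        simp [planeVec]
        field_simp)
    refine ⟨fun q => c q.1 q.2, compatibleFamily_ext_zero (funext fun u => ?_)⟩
    rw [cubicBivectorFamily_zero]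
    have hu : u = ![u 0, u 1] := by funext l; fin_cases l <;> rfl
    conv_rhs => rw [hu]
    exact (hc _ _).symm

theorem finrank_holomorphicBivectorField_two :
    Module.finrank ℂ (holomorphicPolyvectorField 𝓘(ℂ, Fin 2 → ℂ) (CP 2) 2) = 10 := by
  rw [(((holomorphicPolyvectorFieldEquiv (Pi.basisFun ℂ (Fin 2))).trans (sectionEquiv _)).trans
    (LinearEquiv.ofBijective _ cubicBivectorFamily_bijective).symm).finrank_eq]
  simp [Fin.sum_univ_succ]

/-- The matrices with vanishing upper left entry. -/
def planeMatrix (a : Fin 8 → ℂ) : Matrix (Fin 3) (Fin 3) ℂ :=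
  -- Scalar matrices induce the zero field; a zero upper left entry picks one representative modulo
  -- scalars.
  !![0, a 0, a 1; a 2, a 3, a 4; a 5, a 6, a 7]

theorem planeMatrix_add (a b : Fin 8 → ℂ) :
    planeMatrix (a + b) = planeMatrix a + planeMatrix b := by
  ext k l
  fin_cases k <;> fin_cases l <;> simp [planeMatrix]

theorem planeMatrix_smul (c : ℂ) (a : Fin 8 → ℂ) : planeMatrix (c • a) = c • planeMatrix a := by
  ext k l
  fin_cases k <;> fin_cases l <;> simp [planeMatrix]

/-- The vector fields on the projective plane induced by linear vector fields. -/
def planeFieldFamily : (Fin 8 → ℂ) →ₗ[ℂ] compatibleFamily 𝓘(ℂ, Fin 2 → ℂ) (coordPoint (n := 2))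
    (ContinuousLinearMap.toLinearMapRingHom :
      ((Fin 2 → ℂ) →L[ℂ] (Fin 2 → ℂ)) →+* _).toMonoidHom where
  toFun a := ⟨linearFieldInChart (planeMatrix a), by
    rw [mem_compatibleFamily_iff]
    exact ⟨contDiff_linearFieldInChart _, fun i j v hi hj =>
      (tangentCoordChange_linearFieldInChart _ i j v hi hj).symm⟩⟩
  map_add' a b := by
    ext1
    funext i u
    refine Eq.trans ?_ (linearFieldInChart_add _ _ i u)
    exact congrArg (fun A => linearFieldInChart A i u) (planeMatrix_add a b)
  map_smul' c a := by
    ext1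
    funext i u
    refine Eq.trans ?_ (linearFieldInChart_smul _ _ i u)
    exact congrArg (fun A => linearFieldInChart A i u) (planeMatrix_smul c a)

theorem planeFieldFamily_zero (a : Fin 8 → ℂ) (u : Fin 2 → ℂ) :
    (planeFieldFamily a).1 0 u =
      ![a 2 + a 3 * u 0 + a 4 * u 1 - u 0 * (a 0 * u 0 + a 1 * u 1),
        a 5 + a 6 * u 0 + a 7 * u 1 - u 1 * (a 0 * u 0 + a 1 * u 1)] := by
  show linearFieldInChart (planeMatrix a) 0 u = _
  funext l
  fin_cases l <;>
    simp [linearFieldInChart, affineDeriv, planeMatrix, Matrix.mulVec,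
      dotProduct, Fin.sum_univ_succ, finCons_two] <;> ring

/-- For surjectivity, both components in chart 0 have poles of order at most 2 at infinity, hence
are quadratic polynomials. Regularity of the second component in chart 1 then forces their quadratic
parts to be `x * q` and `y * q` with one linear form `q`, as for a linear field. -/
theorem planeFieldFamily_bijective : Function.Bijective planeFieldFamily := by
  constructor
  · rw [injective_iff_map_eq_zero]
    intro a ha
    have h : ∀ x y : ℂ, _ := fun x y => planeFieldFamily_zero a ![x, y]
    rw [ha] at h
    have h0 : ∀ x y : ℂ, 0 = a 2 + a 3 * x + a 4 * y - x * (a 0 * x + a 1 * y) :=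
      fun x y => congrFun (h x y) 0
    have h1 : ∀ x y : ℂ, 0 = a 5 + a 6 * x + a 7 * y - y * (a 0 * x + a 1 * y) :=
      fun x y => congrFun (h x y) 1
    have e2 : a 2 = 0 := by simpa using (h0 0 0).symm
    have e5 : a 5 = 0 := by simpa using (h1 0 0).symm
    have e4 : a 4 = 0 := by simpa [e2] using (h0 0 1).symm
    have e6 : a 6 = 0 := by simpa [e5] using (h1 1 0).symm
    funext l
    fin_cases l
    · show a 0 = 0
      linear_combination (1 / 2 : ℂ) * h0 1 0 + (1 / 2 : ℂ) * h0 (-1) 0 + e2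
    · show a 1 = 0
      linear_combination (1 / 2 : ℂ) * h1 0 1 + (1 / 2 : ℂ) * h1 0 (-1) + e5
    · exact e2
    · show a 3 = 0
      linear_combination (-1 / 2 : ℂ) * h0 1 0 + (1 / 2 : ℂ) * h0 (-1) 0
    · exact e4
    · exact e5
    · exact e6
    · show a 7 = 0
      linear_combination (-1 / 2 : ℂ) * h1 0 1 + (1 / 2 : ℂ) * h1 0 (-1)
  · intro F
    have hF := (mem_compatibleFamily_iff _ _).1 F.2
    have hcont : ∀ i s k, ContinuousAt (fun a => F.1 i ![a, s] k) 0 := fun i s k =>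
      ((continuous_apply k).comp ((hF.1 i).continuous.comp (f := fun a : ℂ => ![a, s])
        (by fun_prop))).continuousAt
    have hdiff : ∀ k, Differentiable ℂ fun p : ℂ × ℂ => F.1 0 ![p.1, p.2] k :=
      differentiable_pi.1 (((hF.1 0).differentiable (by simp)).comp
        (f := fun p : ℂ × ℂ => ![p.1, p.2])
        differentiable_vec_two)
    have h1 : ∀ x y : ℂ, x ≠ 0 → F.1 1 ![x⁻¹, y / x] =
        ![-F.1 0 ![x, y] 0 / x ^ 2, F.1 0 ![x, y] 1 / x - y * F.1 0 ![x, y] 0 / x ^ 2] := by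
      intro x y hx
      have h : _ = tangentCoordChange _ _ _ _ _ := hF.2 0 1 (planeVec x y) one_ne_zero hx
      rw [tangentCoordChange_apply 0 1 _ one_ne_zero hx, affineCoord_planeVec_zero,
        affineCoord_planeVec_one] at h
      rw [h]
      funext l
      fin_cases l <;> simp [affineDeriv, planeVec, Fin.succAbove, finCons_two]
      field_simp
    have h2 : ∀ x y : ℂ, y ≠ 0 → F.1 2 ![y⁻¹, x / y] =
        ![-F.1 0 ![x, y] 1 / y ^ 2, F.1 0 ![x, y] 0 / y - x * F.1 0 ![x, y] 1 / y ^ 2] := by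
      intro x y hy
      have h : _ = tangentCoordChange _ _ _ _ _ := hF.2 0 2 (planeVec x y) one_ne_zero hy
      rw [tangentCoordChange_apply 0 2 _ one_ne_zero hy, affineCoord_planeVec_zero,
        affineCoord_planeVec_two] at h
      rw [h]
      funext l
      fin_cases l <;> simp [affineDeriv, planeVec, Fin.succAbove, finCons_two]
      field_simp
    -- `G` and `K` arise by solving `h1` and `h2` for the chart 0 component.
    obtain ⟨c, hc⟩ := exists_eq_sum_of_totalDegree 2 (f := fun x y => F.1 0 ![x, y] 0)
      (G := fun a s => -F.1 1 ![a, s] 0)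
      (K := fun a s => a * F.1 2 ![a, s] 1 - s * F.1 2 ![a, s] 0)
      (hdiff 0) (fun s => (hcont 1 s 0).neg)
      (fun s => (continuousAt_id.mul (hcont 2 s 1)).sub (continuousAt_const.mul (hcont 2 s 0)))
      (fun x y hx => by rw [h1 x y hx]; simp; field_simp)
      (fun x y hy => by rw [h2 x y hy]; simp; field_simp; ring)
    obtain ⟨d, hd⟩ := exists_eq_sum_of_totalDegree 2 (f := fun x y => F.1 0 ![x, y] 1)
      (G := fun a s => a * F.1 1 ![a, s] 1 - s * F.1 1 ![a, s] 0)
      (K := fun a s => -F.1 2 ![a, s] 0)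
      (hdiff 1)
      (fun s => (continuousAt_id.mul (hcont 1 s 1)).sub (continuousAt_const.mul (hcont 1 s 0)))
      (fun s => (hcont 2 s 0).neg)
      (fun x y hx => by rw [h1 x y hx]; simp; field_simp; ring)
      (fun x y hy => by rw [h2 x y hy]; simp; field_simp)
    replace hc : ∀ x y, F.1 0 ![x, y] 0 = c 0 0 + (c 1 0 * x + c 1 1 * y) +
        (c 2 0 * x ^ 2 + c 2 1 * x * y + c 2 2 * y ^ 2) := fun x y => by
      rw [hc]; simp [Fin.sum_univ_succ]; ring
    replace hd : ∀ x y, F.1 0 ![x, y] 1 = d 0 0 + (d 1 0 * x + d 1 1 * y) +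
        (d 2 0 * x ^ 2 + d 2 1 * x * y + d 2 2 * y ^ 2) := fun x y => by
      rw [hd]; simp [Fin.sum_univ_succ]; ring
    -- On the line `y = s * x` the second component in chart 1, times `x`, is the combination below.
    -- It therefore has degree at most 1 in `x`, and its `x ^ 2` coefficient, extracted by a second
    -- difference, vanishes.
    have hrel : ∀ s : ℂ, d 2 0 + d 2 1 * s + d 2 2 * s ^ 2 -
        s * (c 2 0 + c 2 1 * s + c 2 2 * s ^ 2) = 0 := by
      intro s
      obtain ⟨b, hb⟩ := exists_eq_sum_of_eq_pow_mul_inv 1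
        (f := fun x => F.1 0 ![x, x * s] 1 - s * F.1 0 ![x, x * s] 0)
        (g := fun r => F.1 1 ![r, s] 1) (by simp only [hc, hd]; fun_prop) (hcont 1 s 1)
        (fun x hx => by
          have h := congrFun (h1 x (x * s) hx) 1
          rw [mul_div_cancel_left₀ _ hx] at h
          rw [h]
          simp
          field_simp)
      replace hb : ∀ x, F.1 0 ![x, x * s] 1 - s * F.1 0 ![x, x * s] 0 = b 0 + b 1 * x :=
        fun x => by rw [hb]; simp [Fin.sum_univ_succ]
      simp only [hc, hd] at hb
      linear_combination (1 / 2 : ℂ) * hb 1 + (1 / 2 : ℂ) * hb (-1) - hb 0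
    -- `hrel` is a cubic in `s` that vanishes identically; its four coefficients give `r0` to `r3`.
    have r0 : d 2 0 = 0 := by simpa using hrel 0
    have r2 : d 2 2 = c 2 1 := by
      linear_combination (1 / 2 : ℂ) * hrel 1 + (1 / 2 : ℂ) * hrel (-1) - r0
    have r3 : c 2 2 = 0 := by
      linear_combination (-1 / 6 : ℂ) * hrel 2 + (1 / 3 : ℂ) * hrel 1 - (1 / 6 : ℂ) * r0 +
        (1 / 3 : ℂ) * r2
    have r1 : d 2 1 = c 2 0 := by linear_combination hrel 1 - r0 - r2 + r3
    refine ⟨![-c 2 0, -c 2 1, c 0 0, c 1 0, c 1 1, d 0 0, d 1 0, d 1 1],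
      compatibleFamily_ext_zero (funext fun u => ?_)⟩
    rw [planeFieldFamily_zero]
    have hu : u = ![u 0, u 1] := by funext l; fin_cases l <;> rfl
    have hcu := hc (u 0) (u 1)
    have hdu := hd (u 0) (u 1)
    rw [← hu] at hcu hdu
    funext l
    fin_cases l
    · refine Eq.trans ?_ hcu.symm
      simp [r3]
      ring
    · refine Eq.trans ?_ hdu.symm
      simp [r0, r1, r2]
      ring

theorem finrank_holomorphicVectorField_two :
    Module.finrank ℂ (HolomorphicVectorField 𝓘(ℂ, Fin 2 → ℂ) (CP 2)) = 8 := by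
  rw [((holomorphicVectorFieldEquiv.trans (sectionEquiv _)).trans
    (LinearEquiv.ofBijective _ planeFieldFamily_bijective).symm).finrank_eq]
  simp

end Plane

end CP

/-! ### The product of two projective lines -/

namespace CP

section Quadric

/-- The pairs of coordinate points. -/
def coordPair (i : Fin 2 × Fin 2) : CP 1 × CP 1 := (coordPoint i.1, coordPoint i.2)

theorem exists_chartAt_prod_eq (p : CP 1 × CP 1) : ∃ i : Fin 2 × Fin 2,
    chartAt (ModelProd (Fin 1 → ℂ) (Fin 1 → ℂ)) p =
      chartAt (ModelProd (Fin 1 → ℂ) (Fin 1 → ℂ)) (coordPair i) := by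
  obtain ⟨i, hi⟩ := exists_chartAt_eq p.1
  obtain ⟨j, hj⟩ := exists_chartAt_eq p.2
  refine ⟨(i, j), ?_⟩
  rw [prodChartedSpace_chartAt, prodChartedSpace_chartAt, hi, hj]
  rfl

theorem extChartAt_coordPair (i : Fin 2 × Fin 2) :
    extChartAt (𝓘(ℂ, Fin 1 → ℂ).prod 𝓘(ℂ, Fin 1 → ℂ)) (coordPair i) =
      (affineChart i.1).toPartialEquiv.prod (affineChart i.2).toPartialEquiv := by
  rw [extChartAt_prod, ← extChartAt_coordPoint, ← extChartAt_coordPoint]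
  rfl

theorem coe_extChartAt_coordPair (i : Fin 2 × Fin 2) (p : CP 1 × CP 1) :
    extChartAt (𝓘(ℂ, Fin 1 → ℂ).prod 𝓘(ℂ, Fin 1 → ℂ)) (coordPair i) p =
      (affineCoord i.1 p.1, affineCoord i.2 p.2) := by
  rw [extChartAt_coordPair]; rfl

theorem extChartAt_coordPair_target (i : Fin 2 × Fin 2) :
    (extChartAt (𝓘(ℂ, Fin 1 → ℂ).prod 𝓘(ℂ, Fin 1 → ℂ)) (coordPair i)).target = Set.univ := by
  rw [extChartAt_coordPair]
  exact Set.univ_prod_univ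

theorem chartAt_coordPair_source (i : Fin 2 × Fin 2) :
    (chartAt (ModelProd (Fin 1 → ℂ) (Fin 1 → ℂ)) (coordPair i)).source =
      affineOpen i.1 ×ˢ affineOpen i.2 := by
  rw [prodChartedSpace_chartAt, OpenPartialHomeomorph.prod_source]
  exact congrArg₂ _ (chartAt_coordPoint_source i.1) (chartAt_coordPoint_source i.2)

/-- Sections over the product of two projective lines as compatible families on the products of
the standard affine charts. -/
def pairSectionEquiv {V : Type*} [NormedAddCommGroup V] [NormedSpace ℂ V]
    (ρ : (((Fin 1 → ℂ) × (Fin 1 → ℂ)) →L[ℂ] ((Fin 1 → ℂ) × (Fin 1 → ℂ))) →* Module.End ℂ V) :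
    associatedSection (𝓘(ℂ, Fin 1 → ℂ).prod 𝓘(ℂ, Fin 1 → ℂ)) (CP 1 × CP 1) ρ ≃ₗ[ℂ]
      compatibleFamily (𝓘(ℂ, Fin 1 → ℂ).prod 𝓘(ℂ, Fin 1 → ℂ)) coordPair ρ :=
  associatedSectionEquiv coordPair (fun p => (exists_chartAt_prod_eq p).choose)
    (fun p => (exists_chartAt_prod_eq p).choose_spec) extChartAt_coordPair_target ρ

theorem mem_pairFamily_iff {V : Type*} [NormedAddCommGroup V] [NormedSpace ℂ V]
    (ρ : (((Fin 1 → ℂ) × (Fin 1 → ℂ)) →L[ℂ] ((Fin 1 → ℂ) × (Fin 1 → ℂ))) →* Module.End ℂ V)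
    (F : Fin 2 × Fin 2 → (Fin 1 → ℂ) × (Fin 1 → ℂ) → V) :
    F ∈ compatibleFamily (𝓘(ℂ, Fin 1 → ℂ).prod 𝓘(ℂ, Fin 1 → ℂ)) coordPair ρ ↔
      (∀ i, ContDiff ℂ ω (F i)) ∧ ∀ (i j : Fin 2 × Fin 2) (v w : {v : Fin 2 → ℂ // v ≠ 0}),
        v.1 i.1 ≠ 0 → w.1 i.2 ≠ 0 → v.1 j.1 ≠ 0 → w.1 j.2 ≠ 0 →
        F j (affineCoord j.1 (proj v), affineCoord j.2 (proj w)) =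
          ρ ((tangentCoordChange 𝓘(ℂ, Fin 1 → ℂ) (coordPoint i.1) (coordPoint j.1) (proj v)).prodMap
            (tangentCoordChange 𝓘(ℂ, Fin 1 → ℂ) (coordPoint i.2) (coordPoint j.2) (proj w)))
            (F i (affineCoord i.1 (proj v), affineCoord i.2 (proj w))) := by
  have hsrc : ∀ (i : Fin 2) (v : {v : Fin 2 → ℂ // v ≠ 0}), v.1 i ≠ 0 →
      proj v ∈ (chartAt (Fin 1 → ℂ) (coordPoint i)).source := fun i v h => by
    rw [chartAt_coordPoint_source]; exact h
  refine and_congr Iff.rfl (forall₂_congr fun i j => ?_)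
  simp only [chartAt_coordPair_source, coe_extChartAt_coordPair]
  constructor
  · intro h v w hi hi' hj hj'
    rw [← tangentCoordChange_prod (hsrc _ _ hi) (hsrc _ _ hj) (hsrc _ _ hi') (hsrc _ _ hj')]
    exact h (proj v, proj w) ⟨hi, hi'⟩ ⟨hj, hj'⟩
  · rintro h ⟨p, q⟩ ⟨hi, hi'⟩ ⟨hj, hj'⟩
    obtain ⟨v, rfl⟩ := isQuotientMap_proj.surjective p
    obtain ⟨w, rfl⟩ := isQuotientMap_proj.surjective q
    refine (h v w hi hi' hj hj').trans ?_
    rw [← tangentCoordChange_prod (hsrc _ _ hi) (hsrc _ _ hj) (hsrc _ _ hi') (hsrc _ _ hj')]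
    rfl

theorem pairFamily_ext_zero {V : Type*} [NormedAddCommGroup V] [NormedSpace ℂ V]
    {ρ : (((Fin 1 → ℂ) × (Fin 1 → ℂ)) →L[ℂ] ((Fin 1 → ℂ) × (Fin 1 → ℂ))) →* Module.End ℂ V}
    {F G : compatibleFamily (𝓘(ℂ, Fin 1 → ℂ).prod 𝓘(ℂ, Fin 1 → ℂ)) coordPair ρ}
    (h : F.1 (0, 0) = G.1 (0, 0)) : F = G :=
  compatibleFamily_ext extChartAt_coordPair_target (0, 0) (fun i => by
    rw [chartAt_coordPair_source, extChartAt_coordPair]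
    exact (dense_ofAffine_mem_affineOpen i.1 0).prod (dense_ofAffine_mem_affineOpen i.2 0)) h

/-- The vector `(1, x)`. -/
def lineVec (x : ℂ) : {v : Fin 2 → ℂ // v ≠ 0} :=
  ⟨![1, x], fun h => one_ne_zero (congrFun h 0)⟩

theorem affineCoord_lineVec_zero (x : ℂ) : affineCoord 0 (proj (lineVec x)) = ![x] := by
  funext l; fin_cases l; simp [lineVec]

theorem affineCoord_lineVec_one (x : ℂ) : affineCoord 1 (proj (lineVec x)) = ![x⁻¹] := by
  funext l; fin_cases l; simp [lineVec]

theorem tangentCoordChange_lineVec_zero (x : ℂ) (h : Fin 1 → ℂ) :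
    tangentCoordChange 𝓘(ℂ, Fin 1 → ℂ) (coordPoint 0) (coordPoint 0) (proj (lineVec x)) h = h := by
  rw [tangentCoordChange_apply 0 0 _ one_ne_zero one_ne_zero]
  funext l; fin_cases l; simp [affineDeriv, lineVec]

theorem tangentCoordChange_lineVec_one {x : ℂ} (hx : x ≠ 0) (h : Fin 1 → ℂ) :
    tangentCoordChange 𝓘(ℂ, Fin 1 → ℂ) (coordPoint 0) (coordPoint 1) (proj (lineVec x)) h =
      ![-h 0 / x ^ 2] := by
  rw [tangentCoordChange_apply 0 1 _ one_ne_zero hx]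
  funext l; fin_cases l; simp [affineDeriv, lineVec]

theorem differentiable_pair_vec_one :
    Differentiable ℂ fun p : ℂ × ℂ => ((![p.1], ![p.2]) : (Fin 1 → ℂ) × (Fin 1 → ℂ)) := by
  refine Differentiable.prodMk ?_ ?_ <;> rw [differentiable_pi] <;> intro l <;> fin_cases l
  · exact differentiable_fst
  · exact differentiable_snd

/-- The form of bidegree `(2, 2)` in two pairs of variables with coefficients `c`. -/
def biquadraticForm (c : Fin 3 × Fin 3 → ℂ) (z w : Fin 2 → ℂ) : ℂ :=
  ∑ i : Fin 3, ∑ j : Fin 3,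
    c (i, j) * (z 0 ^ (2 - (i : ℕ)) * z 1 ^ (i : ℕ)) * (w 0 ^ (2 - (j : ℕ)) * w 1 ^ (j : ℕ))

theorem biquadraticForm_smul (c : Fin 3 × Fin 3 → ℂ) (s t : ℂ) (z w : Fin 2 → ℂ) :
    biquadraticForm c (s • z) (t • w) = s ^ 2 * t ^ 2 * biquadraticForm c z w := by
  simp only [biquadraticForm, Finset.mul_sum]
  refine Finset.sum_congr rfl fun i _ => Finset.sum_congr rfl fun j _ => ?_
  have hpow : ∀ (a : ℂ) (k : Fin 3), a ^ 2 = a ^ (2 - (k : ℕ)) * a ^ (k : ℕ) := fun a k => by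
    rw [← pow_add]; congr 1; omega
  simp only [Pi.smul_apply, smul_eq_mul, mul_pow]
  rw [hpow s i, hpow t j]
  ring

/-- The bivector field on the product of two projective lines of a form of bidegree `(2, 2)`. -/
def biquadraticBivectorFamily : (Fin 3 × Fin 3 → ℂ) →ₗ[ℂ]
    compatibleFamily (𝓘(ℂ, Fin 1 → ℂ).prod 𝓘(ℂ, Fin 1 → ℂ)) coordPair
      (detRepresentation ((Fin 1 → ℂ) × (Fin 1 → ℂ))) where
  toFun c := ⟨fun i u => (-1) ^ (i.1 : ℕ) * (-1) ^ (i.2 : ℕ) *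
      biquadraticForm c (i.1.insertNth (1 : ℂ) u.1) (i.2.insertNth (1 : ℂ) u.2), by
    rw [mem_pairFamily_iff]
    refine ⟨fun i => contDiff_const.mul ?_, fun i j v w hi hi' hj hj' => ?_⟩
    · have h1 : ∀ k, ContDiff ℂ ω fun u : (Fin 1 → ℂ) × (Fin 1 → ℂ) =>
          (i.1.insertNth (1 : ℂ) u.1 : Fin 2 → ℂ) k := fun k =>
        (contDiff_insertNth i.1 k).comp contDiff_fst
      have h2 : ∀ k, ContDiff ℂ ω fun u : (Fin 1 → ℂ) × (Fin 1 → ℂ) =>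
          (i.2.insertNth (1 : ℂ) u.2 : Fin 2 → ℂ) k := fun k =>
        (contDiff_insertNth i.2 k).comp contDiff_snd
      exact ContDiff.sum fun k _ => ContDiff.sum fun m _ =>
        (contDiff_const.mul (((h1 0).pow _).mul ((h1 1).pow _))).mul
          (((h2 0).pow _).mul ((h2 1).pow _))
    · rw [detRepresentation_apply, ContinuousLinearMap.coe_prodMap, LinearMap.det_prodMap,
        det_tangentCoordChange_one _ _ v hi hj, det_tangentCoordChange_one _ _ w hi' hj',
        insertNth_affineCoord _ v hi, insertNth_affineCoord _ v hj, insertNth_affineCoord _ w hi',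
        insertNth_affineCoord _ w hj', biquadraticForm_smul, biquadraticForm_smul]
      have hs : ∀ k : Fin 2, ((-1 : ℂ) ^ (k : ℕ)) ^ 2 = 1 := fun k => by
        rw [← pow_mul, mul_comm, pow_mul]; simp
      field_simp
      simp [hs]⟩
  map_add' c d := by
    ext i u
    simp only [biquadraticForm, Pi.add_apply, add_mul, Finset.sum_add_distrib, mul_add,
      Submodule.coe_add]
  map_smul' a c := by
    ext i u
    simp only [biquadraticForm, Pi.smul_apply, smul_eq_mul, RingHom.id_apply, Submodule.coe_smul,
      Finset.mul_sum]
    refine Finset.sum_congr rfl fun i _ => Finset.sum_congr rfl fun m _ => ?_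
    ring

theorem biquadraticBivectorFamily_zero (c : Fin 3 × Fin 3 → ℂ) (x y : ℂ) :
    (biquadraticBivectorFamily c).1 (0, 0) (![x], ![y]) =
      ∑ i : Fin 3, ∑ j : Fin 3, c (i, j) * x ^ (i : ℕ) * y ^ (j : ℕ) := by
  simp [biquadraticBivectorFamily, biquadraticForm]

/-- Changing the chart in one factor multiplies by the determinant of that factor alone, so the pole
order at infinity is at most 2 in each variable separately. -/
theorem biquadraticBivectorFamily_bijective : Function.Bijective biquadraticBivectorFamily := by
  constructor
  · rw [injective_iff_map_eq_zero]
    intro c hc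
    funext ⟨i, j⟩
    refine bidegree_coeff_eq_zero (c := fun i j => c (i, j)) (fun x y => ?_) i j
    have := biquadraticBivectorFamily_zero c x y
    rw [hc] at this
    exact this.symm
  · intro F
    have hF := (mem_pairFamily_iff _ _).1 F.2
    have hdiff : ∀ i, Differentiable ℂ fun p : ℂ × ℂ => F.1 i (![p.1], ![p.2]) := fun i =>
      ((hF.1 i).differentiable (by simp)).comp (f := fun p : ℂ × ℂ => (![p.1], ![p.2]))
        differentiable_pair_vec_one
    have hdiff₁ : ∀ i y, Differentiable ℂ fun x => F.1 i (![x], ![y]) := fun i y =>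
      (hdiff i).comp (f := fun x : ℂ => (x, y)) (by fun_prop)
    have hdiff₂ : ∀ i x, Differentiable ℂ fun y => F.1 i (![x], ![y]) := fun i x =>
      (hdiff i).comp (f := fun y : ℂ => (x, y)) (by fun_prop)
    obtain ⟨c, hc⟩ := exists_eq_sum_of_bidegree 2 2 (f := fun x y => F.1 (0, 0) (![x], ![y]))
      (G := fun a y => -F.1 (1, 0) (![a], ![y])) (K := fun x b => -F.1 (0, 1) (![x], ![b]))
      (hdiff₁ _) (hdiff₂ _) (fun y => (hdiff₁ _ y).continuous.neg.continuousAt)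
      (fun x => (hdiff₂ _ x).continuous.neg.continuousAt) (fun x y hx => by
        have h := hF.2 (0, 0) (1, 0) (lineVec x) (lineVec y) one_ne_zero one_ne_zero hx one_ne_zero
        rw [detRepresentation_apply, ContinuousLinearMap.coe_prodMap, LinearMap.det_prodMap,
          det_tangentCoordChange_one 0 1 _ one_ne_zero hx,
          det_tangentCoordChange_one 0 0 _ one_ne_zero one_ne_zero,
          affineCoord_lineVec_zero, affineCoord_lineVec_one, affineCoord_lineVec_zero] at h
        rw [h]
        simp [lineVec]
        field_simp) (fun x y hy => by
        have h := hF.2 (0, 0) (0, 1) (lineVec x) (lineVec y) one_ne_zero one_ne_zero one_ne_zero hy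
        rw [detRepresentation_apply, ContinuousLinearMap.coe_prodMap, LinearMap.det_prodMap,
          det_tangentCoordChange_one 0 1 _ one_ne_zero hy,
          det_tangentCoordChange_one 0 0 _ one_ne_zero one_ne_zero,
          affineCoord_lineVec_zero, affineCoord_lineVec_one, affineCoord_lineVec_zero] at h
        rw [h]
        simp [lineVec]
        field_simp)
    refine ⟨fun q => c q.1 q.2, pairFamily_ext_zero (funext fun u => ?_)⟩
    have hu : u = (![u.1 0], ![u.2 0]) := by
      ext l <;> fin_cases l <;> rfl
    rw [hu, biquadraticBivectorFamily_zero]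
    exact (hc _ _).symm

theorem finrank_holomorphicBivectorField_one_prod_one :
    Module.finrank ℂ (holomorphicPolyvectorField (𝓘(ℂ, Fin 1 → ℂ).prod 𝓘(ℂ, Fin 1 → ℂ))
      (CP 1 × CP 1) 2) = 9 := by
  -- Any basis serves: the determinant representation does not depend on it.
  have b : Module.Basis (Fin 2) ℂ ((Fin 1 → ℂ) × (Fin 1 → ℂ)) :=
    Module.finBasisOfFinrankEq ℂ _ (by simp)
  rw [(((holomorphicPolyvectorFieldEquiv b).trans (pairSectionEquiv _)).trans
    (LinearEquiv.ofBijective _ biquadraticBivectorFamily_bijective).symm).finrank_eq]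
  simp

/-- The matrices with vanishing upper left entry. -/
def lineMatrix (a : Fin 3 → ℂ) : Matrix (Fin 2) (Fin 2) ℂ := !![0, a 0; a 1, a 2]

theorem lineMatrix_add (a b : Fin 3 → ℂ) : lineMatrix (a + b) = lineMatrix a + lineMatrix b := by
  ext k l
  fin_cases k <;> fin_cases l <;> simp [lineMatrix]

theorem lineMatrix_smul (c : ℂ) (a : Fin 3 → ℂ) : lineMatrix (c • a) = c • lineMatrix a := by
  ext k l
  fin_cases k <;> fin_cases l <;> simp [lineMatrix]

theorem linearFieldInChart_lineMatrix (a : Fin 3 → ℂ) (u : Fin 1 → ℂ) :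
    linearFieldInChart (lineMatrix a) 0 u = ![a 1 + a 2 * u 0 - a 0 * u 0 ^ 2] := by
  funext l
  fin_cases l
  simp [linearFieldInChart, affineDeriv, lineMatrix, Matrix.mulVec, dotProduct, Fin.sum_univ_succ]
  ring

/-- The vector fields on the product of two projective lines induced by pairs of linear vector
fields. -/
def pairFieldFamily : ((Fin 3 → ℂ) × (Fin 3 → ℂ)) →ₗ[ℂ]
    compatibleFamily (𝓘(ℂ, Fin 1 → ℂ).prod 𝓘(ℂ, Fin 1 → ℂ)) coordPair
      (ContinuousLinearMap.toLinearMapRingHom :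
        (((Fin 1 → ℂ) × (Fin 1 → ℂ)) →L[ℂ] ((Fin 1 → ℂ) × (Fin 1 → ℂ))) →+* _).toMonoidHom where
  toFun a := ⟨fun i u => (linearFieldInChart (lineMatrix a.1) i.1 u.1,
      linearFieldInChart (lineMatrix a.2) i.2 u.2), by
    rw [mem_pairFamily_iff]
    exact ⟨fun i => ((contDiff_linearFieldInChart _ _).comp contDiff_fst).prodMk
      ((contDiff_linearFieldInChart _ _).comp contDiff_snd), fun i j v w hi hi' hj hj' =>
      Prod.ext (tangentCoordChange_linearFieldInChart _ _ _ v hi hj).symm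
        (tangentCoordChange_linearFieldInChart _ _ _ w hi' hj').symm⟩⟩
  map_add' a b := by
    ext1
    funext i u
    exact Prod.ext
      ((congrArg (fun A => linearFieldInChart A i.1 u.1) (lineMatrix_add a.1 b.1)).trans
        (linearFieldInChart_add _ _ _ _))
      ((congrArg (fun A => linearFieldInChart A i.2 u.2) (lineMatrix_add a.2 b.2)).trans
        (linearFieldInChart_add _ _ _ _))
  map_smul' c a := by
    ext1
    funext i u
    exact Prod.ext
      ((congrArg (fun A => linearFieldInChart A i.1 u.1) (lineMatrix_smul c a.1)).trans
        (linearFieldInChart_smul _ _ _ _))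
      ((congrArg (fun A => linearFieldInChart A i.2 u.2) (lineMatrix_smul c a.2)).trans
        (linearFieldInChart_smul _ _ _ _))

theorem pairFieldFamily_zero (a : (Fin 3 → ℂ) × (Fin 3 → ℂ)) (x y : ℂ) :
    (pairFieldFamily a).1 (0, 0) (![x], ![y]) =
      (![a.1 1 + a.1 2 * x - a.1 0 * x ^ 2], ![a.2 1 + a.2 2 * y - a.2 0 * y ^ 2]) :=
  Prod.ext (linearFieldInChart_lineMatrix a.1 ![x]) (linearFieldInChart_lineMatrix a.2 ![y])

theorem quadratic_coeff_eq_zero {a : Fin 3 → ℂ}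
    (h : ∀ x : ℂ, 0 = a 1 + a 2 * x - a 0 * x ^ 2) : a = 0 := by
  have e1 : a 1 = 0 := by simpa using (h 0).symm
  funext l
  fin_cases l
  · show a 0 = 0
    linear_combination (1 / 2 : ℂ) * h 1 + (1 / 2 : ℂ) * h (-1) + e1
  · exact e1
  · show a 2 = 0
    linear_combination (-1 / 2 : ℂ) * h 1 + (1 / 2 : ℂ) * h (-1)

/-- The coordinate change is block diagonal. The first component has a pole of order at most 2 in
`x` and is unchanged when the chart in `y` changes, so it is a quadratic polynomial in `x` alone;
the second is symmetric. Each such quadratic is the field of a unique `lineMatrix`. -/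
theorem pairFieldFamily_bijective : Function.Bijective pairFieldFamily := by
  constructor
  · rw [injective_iff_map_eq_zero]
    intro a ha
    have h : ∀ x y : ℂ, _ := fun x y => pairFieldFamily_zero a x y
    rw [ha] at h
    exact Prod.ext
      (quadratic_coeff_eq_zero fun x => congrFun (congrArg Prod.fst (h x 0)) 0)
      (quadratic_coeff_eq_zero fun y => congrFun (congrArg Prod.snd (h 0 y)) 0)
  · intro F
    have hF := (mem_pairFamily_iff _ _).1 F.2
    have hdiff : ∀ i, Differentiable ℂ fun p : ℂ × ℂ => F.1 i (![p.1], ![p.2]) := fun i =>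
      ((hF.1 i).differentiable (by simp)).comp (f := fun p : ℂ × ℂ => (![p.1], ![p.2]))
        differentiable_pair_vec_one
    have hfst : ∀ i, Differentiable ℂ fun p : ℂ × ℂ => (F.1 i (![p.1], ![p.2])).1 0 := fun i =>
      differentiable_pi.1 (hdiff i).fst 0
    have hsnd : ∀ i, Differentiable ℂ fun p : ℂ × ℂ => (F.1 i (![p.1], ![p.2])).2 0 := fun i =>
      differentiable_pi.1 (hdiff i).snd 0
    have hx : ∀ y : ℂ, Differentiable ℂ fun x : ℂ => (x, y) := fun y => by fun_prop
    have hy : ∀ x : ℂ, Differentiable ℂ fun y : ℂ => (x, y) := fun x => by fun_prop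
    have h1 : ∀ x y : ℂ, x ≠ 0 → F.1 (1, 0) (![x⁻¹], ![y]) =
        (![-(F.1 (0, 0) (![x], ![y])).1 0 / x ^ 2], (F.1 (0, 0) (![x], ![y])).2) := by
      intro x y hx
      have h : _ = ContinuousLinearMap.prodMap _ _ _ :=
        hF.2 (0, 0) (1, 0) (lineVec x) (lineVec y) one_ne_zero one_ne_zero hx one_ne_zero
      rw [affineCoord_lineVec_zero, affineCoord_lineVec_one, affineCoord_lineVec_zero] at h
      rw [h]
      exact Prod.ext (tangentCoordChange_lineVec_one hx _) (tangentCoordChange_lineVec_zero y _)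
    have h2 : ∀ x y : ℂ, y ≠ 0 → F.1 (0, 1) (![x], ![y⁻¹]) =
        ((F.1 (0, 0) (![x], ![y])).1, ![-(F.1 (0, 0) (![x], ![y])).2 0 / y ^ 2]) := by
      intro x y hy
      have h : _ = ContinuousLinearMap.prodMap _ _ _ :=
        hF.2 (0, 0) (0, 1) (lineVec x) (lineVec y) one_ne_zero one_ne_zero one_ne_zero hy
      rw [affineCoord_lineVec_zero, affineCoord_lineVec_one, affineCoord_lineVec_zero] at h
      rw [h]
      exact Prod.ext (tangentCoordChange_lineVec_zero x _) (tangentCoordChange_lineVec_one hy _)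
    obtain ⟨c, hc⟩ := exists_eq_sum_of_bidegree 2 0
      (f := fun x y => (F.1 (0, 0) (![x], ![y])).1 0)
      (G := fun a y => -(F.1 (1, 0) (![a], ![y])).1 0)
      (K := fun x b => (F.1 (0, 1) (![x], ![b])).1 0)
      (fun y => (hfst _).comp (hx y)) (fun x => (hfst _).comp (hy x))
      (fun y => ((hfst _).comp (hx y)).continuous.neg.continuousAt)
      (fun x => ((hfst _).comp (hy x)).continuous.continuousAt)
      (fun x y hx => by rw [h1 x y hx]; simp; field_simp)
      (fun x y hy => by rw [h2 x y hy]; simp)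
    obtain ⟨d, hd⟩ := exists_eq_sum_of_bidegree 0 2
      (f := fun x y => (F.1 (0, 0) (![x], ![y])).2 0)
      (G := fun a y => (F.1 (1, 0) (![a], ![y])).2 0)
      (K := fun x b => -(F.1 (0, 1) (![x], ![b])).2 0)
      (fun y => (hsnd _).comp (hx y)) (fun x => (hsnd _).comp (hy x))
      (fun y => ((hsnd _).comp (hx y)).continuous.continuousAt)
      (fun x => ((hsnd _).comp (hy x)).continuous.neg.continuousAt)
      (fun x y hx => by rw [h1 x y hx]; simp)
      (fun x y hy => by rw [h2 x y hy]; simp; field_simp)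
    refine ⟨(![-c 2 0, c 0 0, c 1 0], ![-d 0 2, d 0 0, d 0 1]),
      pairFamily_ext_zero (funext fun u => ?_)⟩
    have hu : u = (![u.1 0], ![u.2 0]) := by
      ext l <;> fin_cases l <;> rfl
    rw [hu, pairFieldFamily_zero]
    refine Prod.ext (funext fun l => ?_) (funext fun l => ?_) <;> fin_cases l
    · refine Eq.trans ?_ (hc (u.1 0) (u.2 0)).symm
      simp [Fin.sum_univ_succ]
      ring
    · refine Eq.trans ?_ (hd (u.1 0) (u.2 0)).symm
      simp [Fin.sum_univ_succ]
      ring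

theorem finrank_holomorphicVectorField_one_prod_one :
    Module.finrank ℂ (HolomorphicVectorField (𝓘(ℂ, Fin 1 → ℂ).prod 𝓘(ℂ, Fin 1 → ℂ))
      (CP 1 × CP 1)) = 6 := by
  rw [((holomorphicVectorFieldEquiv.trans (pairSectionEquiv _)).trans
    (LinearEquiv.ofBijective _ pairFieldFamily_bijective).symm).finrank_eq]
  simp

end Quadric

end CP

end

theorem mainTheorem7 :
    (Module.finrank ℂ
        (holomorphicPolyvectorField (𝓘(ℂ, Fin 1 → ℂ).prod 𝓘(ℂ, Fin 1 → ℂ)) (CP 1 × CP 1) 2) = 9 ∧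
      Module.finrank ℂ
        (HolomorphicVectorField (𝓘(ℂ, Fin 1 → ℂ).prod 𝓘(ℂ, Fin 1 → ℂ)) (CP 1 × CP 1)) = 6) ∧
    (Module.finrank ℂ (holomorphicPolyvectorField 𝓘(ℂ, Fin 2 → ℂ) (CP 2) 2) = 10 ∧
      Module.finrank ℂ (HolomorphicVectorField 𝓘(ℂ, Fin 2 → ℂ) (CP 2)) = 8) :=
  ⟨⟨CP.finrank_holomorphicBivectorField_one_prod_one,
    CP.finrank_holomorphicVectorField_one_prod_one⟩,
    CP.finrank_holomorphicBivectorField_two, CP.finrank_holomorphicVectorField_two⟩
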